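/- **Setting.** Let $n\ge 0$ and let $f:\mathbb R^n\to\mathbb R$ be twice continuously differentiable with $\|\nabla f(x)-\nabla f(y)\|\le M\|x-y\|$ and $\|\nabla^2 f(x)-\nabla^2 f(y)\|\le L\|x-y\|$ for all $x,y$ (operator norm for the Hessians), where $M,L>0$. Let $m>0$ and assume that all critical points are non-degenerate: for some $\kappa>2m$, every eigenvalue $\lambda$ of $\nabla^2 f(c)$ at every critical point $c$ satisfies $|\lambda|>\kappa$. Assume further that small gradients occur only near critical points: for some $\delta>0$, every $x$ with $\|\nabla f(x)\|\le\delta$ lies at distance less than $m/L$ from some critical point. Finally let $x_0\in\mathbb R^n$, and assume that $f$ is bounded below, $f(x_0)-f(y)\le D$ for all $y$. **Method.** For a symmetric matrix $H=Q\Lambda Q^\top$ ($Q$ orthogonal, $\Lambda$ diagonal) the PT-inverse is $H_m^{-1}=Q|\Lambda|_m^{-1}Q^\top$, where $|\Lambda|_m$ is diagonal with entries $|\Lambda_{ii}|$ if $|\Lambda_{ii}|\ge m$ and $m$ otherwise. Fix $\alpha\in(0,1/2)$ and $\beta,\gamma,\zeta\in(0,1)$. An *NCN step* replaces $x$ by $x+\eta\,\Delta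 x$, where $\Delta x=-(\nabla^2 f(x))_m^{-1}\nabla f(x)$ and $\eta$ is the first of the numbers $1,\beta,\beta^2,\dots$ with $f(x+\eta\Delta x)\le f(x)+\alpha\eta\,\nabla f(x)^\top\Delta x$. The *noisy nonconvex Newton method* with accuracy $\varepsilon>0$, started at $x_0$, repeats the following: if $\|\nabla f(x)\|>\varepsilon$, perform an NCN step; if $\|\nabla f(x)\|\le\varepsilon$ and $\lambda_{\min}(\nabla^2 f(x))<0$, draw independent Gaussian vectors $X$ with independent coordinates of mean $0$ and standard deviation $2\varepsilon/m$ until $\|\nabla f(x+X)\|\le(2\sqrt n\,M/m+1)\varepsilon$, replace $x$ by $x+X$, and perform $1+\lceil\log(1/\gamma)/\log(2-\zeta)\rceil$ NCN steps; otherwise stop. Every NCN step and every draw, accepted or not, counts as one iteration. **Theorem.** There are constants $C,\varepsilon_0>0$, depending only on $n,M,L,m,\alpha,\beta,\gamma,\zeta,\delta,D$, such that for all $f$, $x_0$ as above, all $\varepsilon\in(0,\varepsilon_0)$ and all $p\in(0,1)$, with probability at least $1-p$ the method stops after at most $$C\left(1+\log\frac1p+\log\frac1\varepsilon\right)$$ iterations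 at a point $\hat x$ with $\|\nabla f(\hat x)\|\le\varepsilon$ and $\nabla^2 f(\hat x)\succ0$, and $f$ has a local minimizer $z$ with $m\|\hat x-z\|\le\varepsilon$. -/

import Mathlib

open MeasureTheory ProbabilityTheory Set
open scoped Gradient RealInnerProductSpace

noncomputable section

namespace NCN

/-- The Euclidean space `ℝⁿ`. -/
abbrev E (n : ℕ) : Type := EuclideanSpace ℝ (Fin n)

/-- The Hessian of `f` at `x`, as the derivative of the gradient field. -/
def hessian {n : ℕ} (f : E n → ℝ) (x : E n) : E n →L[ℝ] E n :=
  fderiv ℝ (gradient f) x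

/-- The truncated absolute value: `|t|` if `|t| ≥ m`, and `m` otherwise. -/
def truncAbs (m t : ℝ) : ℝ := if m ≤ |t| then |t| else m

/-- The positive definite truncated (PT-)inverse `Q |Λ|ₘ⁻¹ Qᵀ` of a symmetric operator
`T = Q Λ Qᵀ`, applied to `v`. (The value for a non-symmetric operator is irrelevant: the Hessian
of a `C²` function is symmetric, see `hessian_isSymmetric`.) -/
def ptInverse {n : ℕ} (m : ℝ) (T : E n →L[ℝ] E n) (v : E n) : E n :=
  open Classical in
  if h : (T : E n →ₗ[ℝ] E n).IsSymmetric then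
    ∑ i : Fin n,
      ((truncAbs m (h.eigenvalues finrank_euclideanSpace_fin i))⁻¹ *
        ⟪h.eigenvectorBasis finrank_euclideanSpace_fin i, v⟫) •
          h.eigenvectorBasis finrank_euclideanSpace_fin i
  else 0

theorem hessian_isSymmetric {n : ℕ} {f : E n → ℝ} (hf : ContDiff ℝ 2 f) (x : E n) :
    (hessian f x : E n →ₗ[ℝ] E n).IsSymmetric := by
  have hd : DifferentiableAt ℝ (fderiv ℝ f) x :=
    ((hf.fderiv_right (m := 1) (by norm_num)).differentiable (by norm_num)) x
  have hs : IsSymmSndFDerivAt ℝ f x := hf.contDiffAt.isSymmSndFDerivAt (by simp)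
  have key : ∀ v w : E n, ⟪hessian f x v, w⟫ = fderiv ℝ (fderiv ℝ f) x v w := by
    intro v w
    let g : (E n →L[ℝ] ℝ) →ₗ[ℝ] E n :=
      { toFun := (InnerProductSpace.toDual ℝ (E n)).symm
        map_add' := map_add _
        map_smul' := fun c u => by simp }
    have h1 : HasFDerivAt (gradient f)
        ((LinearMap.toContinuousLinearMap g).comp (fderiv ℝ (fderiv ℝ f) x)) x :=
      (LinearMap.toContinuousLinearMap g).hasFDerivAt.comp x hd.hasFDerivAt
    rw [hessian, h1.fderiv]
    simp [g]
  intro v w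
  have h2 := key v w
  have h3 := key w v
  rw [ContinuousLinearMap.coe_coe, h2, real_inner_comm, h3]
  exact hs v w

/-- The (descent) Newton direction `-Hₘ(x)⁻¹ ∇f(x)`. -/
def direction {n : ℕ} (m : ℝ) (f : E n → ℝ) (x : E n) : E n :=
  -ptInverse m (hessian f x) (∇ f x)

/-- The step size of the backtracking line search: `β ^ j` for the first `j` that satisfies the
sufficient decrease condition. -/
def stepSize {n : ℕ} (m α β : ℝ) (f : E n → ℝ) (x : E n) : ℝ :=
  β ^ sInf {j : ℕ | f (x + β ^ j • direction m f x) ≤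
    f x + α * β ^ j * ⟪∇ f x, direction m f x⟫}

/-- One nonconvex Newton step with backtracking line search. -/
def newtonStep {n : ℕ} (m α β : ℝ) (f : E n → ℝ) (x : E n) : E n :=
  x + stepSize m α β f x • direction m f x

/-- The least eigenvalue of the Hessian at `x` is negative. -/
def HasNegativeCurvature {n : ℕ} (f : E n → ℝ) (x : E n) : Prop :=
  ∃ v : E n, ⟪hessian f x v, v⟫ < 0

/-- The number of Newton steps performed after each injection of noise. -/
def burst (γ ζ : ℝ) : ℕ := 1 + ⌈Real.log (1 / γ) / Real.log (2 - ζ)⌉₊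

/-- State of the method: the iterate, and the number of Newton steps that remain to be performed
before the next test of the gradient. -/
abbrev State (n : ℕ) : Type := E n × ℕ

/-- One iteration of the noisy nonconvex Newton method, `ξ` being the Gaussian vector available in
this iteration. Every Newton step and every drawing of a Gaussian vector, accepted or not, is an
iteration. -/
def iterStep {n : ℕ} (M m α β γ ζ ε : ℝ) (f : E n → ℝ) (ξ : E n) (s : State n) : State n :=
  open Classical in
  if 0 < s.2 then (newtonStep m α β f s.1, s.2 - 1)
  else if ε < ‖∇ f s.1‖ then (newtonStep m α β f s.1, 0)
  else if HasNegativeCurvature f s.1 then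
    if ‖∇ f (s.1 + ξ)‖ ≤ (2 * Real.sqrt n * (M / m) + 1) * ε then (s.1 + ξ, burst γ ζ)
    else s
  else s

/-- The state after `k` iterations, started at `x₀` and driven by the vectors `ξ 0, ξ 1, …`. -/
def run {n : ℕ} (M m α β γ ζ ε : ℝ) (f : E n → ℝ) (x₀ : E n) (ξ : ℕ → E n) : ℕ → State n
  | 0 => (x₀, 0)
  | k + 1 => iterStep M m α β γ ζ ε f (ξ k) (run M m α β γ ζ ε f x₀ ξ k)

/-- The stopping criterion of the method. -/
def Stopped {n : ℕ} (ε : ℝ) (f : E n → ℝ) (s : State n) : Prop :=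
  s.2 = 0 ∧ ‖∇ f s.1‖ ≤ ε ∧ ¬ HasNegativeCurvature f s.1

/-- The vectors `ξ k` are independent, with independent centred Gaussian coordinates of standard
deviation `σ`. -/
def IsGaussianNoise {n : ℕ} {Ω : Type*} [MeasurableSpace Ω] (P : Measure Ω) (σ : ℝ)
    (ξ : ℕ → Ω → E n) : Prop :=
  iIndepFun (fun (q : ℕ × Fin n) (ω : Ω) => ξ q.1 ω q.2) P ∧
    ∀ (k : ℕ) (i : Fin n),
      HasLaw (fun ω => ξ k ω i) (gaussianReal 0 (Real.toNNReal (σ ^ 2))) P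

/-- Standing assumptions on the objective: it is `C²`, its gradient is `M`-Lipschitz, its Hessian
is `L`-Lipschitz, and all eigenvalues of the Hessian at all critical points exceed `κ` in
absolute value. -/
structure IsAdmissible {n : ℕ} (M L κ : ℝ) (f : E n → ℝ) : Prop where
  contDiff : ContDiff ℝ 2 f
  gradient_lipschitz : ∀ x y, ‖∇ f x - ∇ f y‖ ≤ M * ‖x - y‖
  hessian_lipschitz : ∀ x y, ‖hessian f x - hessian f y‖ ≤ L * ‖x - y‖
  nondegenerate : ∀ c, ∇ f c = 0 → ∀ t : ℝ,
    Module.End.HasEigenvalue (hessian f c : E n →ₗ[ℝ] E n) t → κ < |t|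

end NCN

end

/-!
The proof is a drift argument: an explicit function `V` of the state of the method decreases in the
mean by a factor `ρ < 1` in every iteration, `V` is at least `1` until the method stops, and
`log V` is `O(1 + log (1 / ε))` at the start. Hence the probability that the method has not stopped
after `k` iterations is at most `ρ ^ k V (x₀, 0)`, which is below `p` once `k` is a large multiple of
`1 + log (1 / p) + log (1 / ε)` (`survival_le_pow_mul`, `Landscape.measure_not_stopped_le`). When
the method stops, the critical point near the iterate has a positive definite Hessian, and is the
local minimizer sought (`IsAdmissible.conclusion_of_not_hasNegativeCurvature`).

The function is `V = exp Φ` up to normalization, where the potential `Φ` of a state `(x, r)` is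
`θ f(x) + a arsinh ((f(x) - f(c)) / ε²) + 1 [f(x) - f(c) > -(M / m²) ε²] + τ r`,
the two middle terms being present only if `x` is near a critical point `c`. The weight `θ` is of
order `log (1 / ε)`, while `a` and `τ` are small constants.

* Every Newton step decreases `f` by at least a constant times `‖∇ f x‖²`
  (`IsAdmissible.newtonStep_le`). Where the gradient is not small, this pays for every possible
  change of the middle terms, whose size is `O(log (1 / ε))`.
* Near a critical point `c` one has `|f x - f c| = O(‖∇ f x‖²)`. So the gap `u = f x - f c` decreases
  by a fixed fraction of `ε² + |u|` in each step with `‖∇ f x‖ > ε`: it shrinks geometrically while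
  positive and grows geometrically in absolute value once negative. In both regimes `arsinh (u / ε²)`,
  a signed logarithm, decreases by a constant (`Landscape.pointPotential_newtonStep_le`). Thus
  approach to a minimizer, approach to a saddle and escape from it need no separate treatment, and the
  gradient need not be decomposed along the eigenspaces of the Hessian. In a burst, `τ r` decreases.
* Noise `X = (2 ε / m) Z` near a saddle increases `Φ` by at most a small multiple of `1 + ‖Z‖²`, and
  with probability bounded below it reaches the set `f ≤ f(c) - (M / m²) ε²`, where the indicator
  vanishes (`Landscape.exists_good_ball`). Since `1 + ‖Z‖²` has exponential moments arbitrarily close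
  to `1`, by Fernique's theorem, the mean of `V` decreases (`Landscape.lintegral_driftFunction_le`).

The Newton direction involves an eigenbasis obtained by choice; it is a measurable function of the
iterate because it is a limit of polynomials in the Hessian (`IsAdmissible.measurable_direction`).
-/

namespace NCN

/-! ### First- and second-order estimates for the objective -/

/-- A quadratic bound on the derivative over `[0, 1]` integrates to a bound on the increment. -/
theorem le_add_of_deriv_le_quadratic {φ φ' : ℝ → ℝ} {a b c : ℝ}
    (hφ : ∀ s, HasDerivAt φ (φ' s) s)
    (hle : ∀ s ∈ Icc (0 : ℝ) 1, φ' s ≤ a + b * s + c * s ^ 2) :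
    φ 1 ≤ φ 0 + a + b / 2 + c / 3 := by
  have hB : ∀ s : ℝ, HasDerivAt
      (fun s : ℝ => φ 0 + a * s + b / 2 * s ^ 2 + c / 3 * s ^ 3) (a + b * s + c * s ^ 2) s := by
    intro s
    have h1 := ((hasDerivAt_id s).const_mul a).const_add (φ 0)
    have h2 := ((hasDerivAt_pow 2 s).const_mul (b / 2))
    have h3 := ((hasDerivAt_pow 3 s).const_mul (c / 3))
    have h := (h1.add h2).add h3
    have he : a * 1 + b / 2 * (((2 : ℕ) : ℝ) * s ^ (2 - 1)) +
        c / 3 * (((3 : ℕ) : ℝ) * s ^ (3 - 1)) = a + b * s + c * s ^ 2 := by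
      norm_num
      ring
    rw [he] at h
    exact h
  have h := image_le_of_deriv_right_le_deriv_boundary (a := 0) (b := 1) (f := φ) (f' := φ')
    (fun s _ => (hφ s).continuousAt.continuousWithinAt)
    (fun s _ => (hφ s).hasDerivWithinAt) (by simp)
    (fun s _ => (hB s).continuousAt.continuousWithinAt)
    (fun s _ => (hB s).hasDerivWithinAt) (fun s hs => hle s ⟨hs.1, hs.2.le⟩)
    (show (1 : ℝ) ∈ Icc (0 : ℝ) 1 by simp)
  simp only [mul_one, one_pow] at h
  exact h

section Objective

variable {n : ℕ} {f : E n → ℝ} {M L m κ : ℝ}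

theorem IsAdmissible.hasFDerivAt_gradient (hf : IsAdmissible M L κ f) (x : E n) :
    HasFDerivAt (gradient f) (hessian f x) x := by
  have hd : DifferentiableAt ℝ (fderiv ℝ f) x :=
    ((hf.contDiff.fderiv_right (m := 1) (by norm_num)).differentiable (by norm_num)) x
  exact ((InnerProductSpace.toDual ℝ (E n)).symm.differentiable.differentiableAt.comp x
    hd).hasFDerivAt

theorem IsAdmissible.continuous_gradient (hf : IsAdmissible M L κ f) : Continuous (gradient f) :=
  continuous_iff_continuousAt.2 fun x => (hf.hasFDerivAt_gradient x).continuousAt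

theorem IsAdmissible.continuous_hessian (hf : IsAdmissible M L κ f) : Continuous (hessian f) :=
  (LipschitzWith.of_dist_le_mul (K := L.toNNReal) fun x y => by
    rw [dist_eq_norm, dist_eq_norm]
    exact (hf.hessian_lipschitz x y).trans
      (mul_le_mul_of_nonneg_right (Real.le_coe_toNNReal L) (norm_nonneg _))).continuous

theorem IsAdmissible.norm_hessian_le (hf : IsAdmissible M L κ f) (hM : 0 ≤ M) (x : E n) :
    ‖hessian f x‖ ≤ M :=
  (hf.hasFDerivAt_gradient x).le_of_lip' hM
    (Filter.Eventually.of_forall fun y => hf.gradient_lipschitz y x)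

theorem IsAdmissible.inner_hessian_comm (hf : IsAdmissible M L κ f) (x v w : E n) :
    ⟪hessian f x v, w⟫ = ⟪v, hessian f x w⟫ :=
  hessian_isSymmetric hf.contDiff x v w

theorem IsAdmissible.hasDerivAt_comp_line (hf : IsAdmissible M L κ f) (x d : E n) (s : ℝ) :
    HasDerivAt (fun s : ℝ => f (x + s • d)) ⟪∇ f (x + s • d), d⟫ s := by
  have h1 : HasGradientAt f (∇ f (x + s • d)) (x + s • d) :=
    ((hf.contDiff.differentiable (by norm_num)) _).hasGradientAt
  have h2 : HasDerivAt (fun s : ℝ => x + s • d) d s := by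
    simpa using ((hasDerivAt_id s).smul_const d).const_add x
  exact h1.hasFDerivAt.comp_hasDerivAt s h2

theorem IsAdmissible.norm_gradient_sub_sub_le (hf : IsAdmissible M L κ f) (hL : 0 ≤ L)
    (x y : E n) : ‖∇ f y - ∇ f x - hessian f x (y - x)‖ ≤ L * ‖y - x‖ ^ 2 := by
  have h := (convex_closedBall x ‖y - x‖).norm_image_sub_le_of_norm_hasFDerivWithin_le'
    (f := gradient f) (f' := hessian f) (φ := hessian f x) (C := L * ‖y - x‖)
    (x := x) (y := y) (fun z _ => (hf.hasFDerivAt_gradient z).hasFDerivWithinAt)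
    (fun z hz => (hf.hessian_lipschitz z x).trans
      (mul_le_mul_of_nonneg_left (by simpa [dist_eq_norm] using hz) hL))
    (by simp) (by simp [dist_eq_norm])
  calc _ ≤ _ := h
    _ = _ := by ring

theorem IsAdmissible.le_quadratic (hf : IsAdmissible M L κ f) (x d : E n) :
    f (x + d) ≤ f x + ⟪∇ f x, d⟫ + M / 2 * ‖d‖ ^ 2 := by
  have h := le_add_of_deriv_le_quadratic (φ := fun s : ℝ => f (x + s • d))
    (a := ⟪∇ f x, d⟫) (b := M * ‖d‖ ^ 2) (c := 0) (hf.hasDerivAt_comp_line x d)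
    (fun s hs => by
      have h1 : ⟪∇ f (x + s • d) - ∇ f x, d⟫ ≤ M * (s * ‖d‖) * ‖d‖ := by
        refine (real_inner_le_norm _ _).trans (mul_le_mul_of_nonneg_right ?_ (norm_nonneg _))
        refine (hf.gradient_lipschitz _ _).trans_eq ?_
        rw [add_sub_cancel_left, norm_smul, Real.norm_of_nonneg hs.1]
      rw [inner_sub_left] at h1
      nlinarith)
  simp only [one_smul, zero_smul, add_zero] at h
  linarith

theorem IsAdmissible.quadratic_le (hf : IsAdmissible M L κ f) (x d : E n) :
    f x + ⟪∇ f x, d⟫ - M / 2 * ‖d‖ ^ 2 ≤ f (x + d) := by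
  have h := le_add_of_deriv_le_quadratic (φ := fun s : ℝ => -f (x + s • d))
    (a := -⟪∇ f x, d⟫) (b := M * ‖d‖ ^ 2) (c := 0)
    (fun s => (hf.hasDerivAt_comp_line x d s).neg)
    (fun s hs => by
      have h1 : ⟪∇ f x - ∇ f (x + s • d), d⟫ ≤ M * (s * ‖d‖) * ‖d‖ := by
        refine (real_inner_le_norm _ _).trans (mul_le_mul_of_nonneg_right ?_ (norm_nonneg _))
        refine (hf.gradient_lipschitz _ _).trans_eq ?_
        rw [sub_add_cancel_left, norm_neg, norm_smul, Real.norm_of_nonneg hs.1]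
      rw [inner_sub_left] at h1
      nlinarith)
  simp only [one_smul, zero_smul, add_zero] at h
  linarith

/-- Second-order Taylor upper bound at a critical point. -/
theorem IsAdmissible.le_cubic (hf : IsAdmissible M L κ f) (hL : 0 ≤ L) {c : E n}
    (hc : ∇ f c = 0) (d : E n) :
    f (c + d) ≤ f c + ⟪hessian f c d, d⟫ / 2 + L / 3 * ‖d‖ ^ 3 := by
  have h := le_add_of_deriv_le_quadratic (φ := fun s : ℝ => f (c + s • d))
    (a := 0) (b := ⟪hessian f c d, d⟫) (c := L * ‖d‖ ^ 3) (hf.hasDerivAt_comp_line c d)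
    (fun s hs => by
      have h1 : ⟪∇ f (c + s • d) - ∇ f c - hessian f c (s • d), d⟫ ≤
          L * (s * ‖d‖) ^ 2 * ‖d‖ := by
        refine (real_inner_le_norm _ _).trans (mul_le_mul_of_nonneg_right ?_ (norm_nonneg _))
        have h2 := hf.norm_gradient_sub_sub_le hL c (c + s • d)
        rw [add_sub_cancel_left, norm_smul, Real.norm_of_nonneg hs.1] at h2
        exact h2
      rw [hc, sub_zero, inner_sub_left, map_smul, real_inner_smul_left] at h1
      nlinarith)
  simp only [one_smul, zero_smul, add_zero] at h
  linarith

/-! ### Nondegenerate critical points -/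

/-- At a critical point the Hessian expands every vector by at least the spectral gap. -/
theorem IsAdmissible.norm_hessian_apply_ge (hf : IsAdmissible M L κ f) (hκ : 0 ≤ κ) {c : E n}
    (hc : ∇ f c = 0) (v : E n) : κ * ‖v‖ ≤ ‖hessian f c v‖ := by
  have hT := hessian_isSymmetric hf.contDiff c
  set b := hT.eigenvectorBasis finrank_euclideanSpace_fin with hb
  set μ := hT.eigenvalues finrank_euclideanSpace_fin with hμ
  have h1 : (κ * ‖v‖) ^ 2 ≤ ‖hessian f c v‖ ^ 2 := by
    rw [mul_pow, ← b.sum_sq_norm_inner_right v, ← b.sum_sq_norm_inner_right (hessian f c v),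
      Finset.mul_sum]
    refine Finset.sum_le_sum fun i _ => ?_
    have h2 : ⟪b i, hessian f c v⟫ = μ i * ⟪b i, v⟫ := by
      rw [← hf.inner_hessian_comm]
      have := hT.apply_eigenvectorBasis finrank_euclideanSpace_fin i
      rw [ContinuousLinearMap.coe_coe] at this
      rw [hb, this, real_inner_smul_left]
      rfl
    rw [h2, norm_mul, mul_pow]
    refine mul_le_mul_of_nonneg_right ?_ (by positivity)
    have h3 := hf.nondegenerate c hc (μ i)
      (hT.hasEigenvalue_eigenvalues finrank_euclideanSpace_fin i)
    exact pow_le_pow_left₀ hκ h3.le 2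
  exact le_of_sq_le_sq h1 (norm_nonneg _)

/-- Around a critical point, the distance is controlled by the gradient. -/
theorem IsAdmissible.mul_norm_sub_le_norm_gradient (hf : IsAdmissible M L κ f) (hL : 0 ≤ L)
    (hκ : 0 ≤ κ) {c : E n} (hc : ∇ f c = 0) (x : E n) :
    (κ - L * ‖x - c‖) * ‖x - c‖ ≤ ‖∇ f x‖ := by
  have h1 := hf.norm_gradient_sub_sub_le hL c x
  have h2 := hf.norm_hessian_apply_ge hκ hc (x - c)
  rw [hc, sub_zero, norm_sub_rev] at h1
  have h3 := norm_sub_norm_le (hessian f c (x - c)) (∇ f x)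
  nlinarith

theorem IsAdmissible.eq_of_norm_sub_lt (hf : IsAdmissible M L κ f) (hL : 0 < L) (hm : 0 < m)
    (hκ : 2 * m < κ) {c c' : E n} (hc : ∇ f c = 0) (hc' : ∇ f c' = 0)
    (h : ‖c' - c‖ < 2 * (m / L)) : c' = c := by
  have h1 := hf.mul_norm_sub_le_norm_gradient hL.le (by linarith) hc c'
  rw [hc', norm_zero] at h1
  have h2 : L * ‖c' - c‖ < 2 * m := by
    calc L * ‖c' - c‖ < L * (2 * (m / L)) := mul_lt_mul_of_pos_left h hL
      _ = 2 * m := by field_simp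
  have h3 : ‖c' - c‖ = 0 := by
    by_contra h0
    have : 0 < ‖c' - c‖ := lt_of_le_of_ne (norm_nonneg _) (Ne.symm h0)
    nlinarith
  exact sub_eq_zero.1 (norm_eq_zero.1 h3)

theorem IsAdmissible.mul_norm_sub_le (hf : IsAdmissible M L κ f) (hL : 0 < L) (hm : 0 < m)
    (hκ : 2 * m < κ) {c x : E n} (hc : ∇ f c = 0) (h : ‖x - c‖ ≤ m / L) :
    m * ‖x - c‖ ≤ ‖∇ f x‖ := by
  have h1 := hf.mul_norm_sub_le_norm_gradient hL.le (by linarith) hc x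
  have h2 : L * ‖x - c‖ ≤ m := (le_div_iff₀' hL).1 h
  nlinarith [norm_nonneg (x - c)]

theorem IsAdmissible.abs_sub_critical_le (hf : IsAdmissible M L κ f) {c : E n} (hc : ∇ f c = 0)
    (x : E n) : |f x - f c| ≤ M / 2 * ‖x - c‖ ^ 2 := by
  have h1 := hf.le_quadratic c (x - c)
  have h2 := hf.quadratic_le c (x - c)
  rw [hc, inner_zero_left, add_sub_cancel] at h1 h2
  rw [abs_le]
  constructor <;> linarith

/-- In terms of the gradient: the gap to the critical value is of the order of its square. -/
theorem IsAdmissible.abs_sub_critical_le_norm_gradient (hf : IsAdmissible M L κ f) (hM : 0 ≤ M)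
    (hL : 0 < L) (hm : 0 < m) (hκ : 2 * m < κ) {c x : E n} (hc : ∇ f c = 0)
    (h : ‖x - c‖ ≤ m / L) : |f x - f c| ≤ M / (2 * m ^ 2) * ‖∇ f x‖ ^ 2 := by
  have h1 := hf.mul_norm_sub_le hL hm hκ hc h
  calc |f x - f c| ≤ M / 2 * ‖x - c‖ ^ 2 := hf.abs_sub_critical_le hc x
    _ = M / (2 * m ^ 2) * (m * ‖x - c‖) ^ 2 := by field_simp
    _ ≤ _ := by gcongr

theorem IsAdmissible.abs_inner_hessian_sub_le (hf : IsAdmissible M L κ f) (x y v : E n) :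
    |⟪hessian f x v, v⟫ - ⟪hessian f y v, v⟫| ≤ L * ‖x - y‖ * ‖v‖ ^ 2 := by
  rw [← inner_sub_left, ← sub_apply]
  calc _ ≤ ‖(hessian f x - hessian f y) v‖ * ‖v‖ := abs_real_inner_le_norm _ _
    _ ≤ ‖hessian f x - hessian f y‖ * ‖v‖ * ‖v‖ := by
        gcongr; exact ContinuousLinearMap.le_opNorm _ _
    _ ≤ L * ‖x - y‖ * ‖v‖ * ‖v‖ := by gcongr; exact hf.hessian_lipschitz x y
    _ = _ := by ring

/-- If all eigenvalues at a critical point are positive, the Hessian there is bounded below. -/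
theorem IsAdmissible.inner_hessian_ge_of_no_neg_eigenvalue (hf : IsAdmissible M L κ f)
    (hκ : 2 * m < κ) {c : E n} (hc : ∇ f c = 0)
    (h : ∀ (t : ℝ) (v : E n), ‖v‖ = 1 → hessian f c v = t • v → ¬ t < -(2 * m)) (v : E n) :
    2 * m * ‖v‖ ^ 2 ≤ ⟪hessian f c v, v⟫ := by
  have hT := hessian_isSymmetric hf.contDiff c
  set b := hT.eigenvectorBasis finrank_euclideanSpace_fin with hb
  set μ := hT.eigenvalues finrank_euclideanSpace_fin with hμ
  have hbμ : ∀ i, hessian f c (b i) = μ i • b i := fun i => by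
    have := hT.apply_eigenvectorBasis finrank_euclideanSpace_fin i
    rw [ContinuousLinearMap.coe_coe] at this
    rw [hb, this]
    rfl
  rw [← b.sum_sq_norm_inner_right v, Finset.mul_sum, ← b.sum_inner_mul_inner]
  refine Finset.sum_le_sum fun i _ => ?_
  rw [hf.inner_hessian_comm, hbμ, real_inner_smul_right, real_inner_comm, Real.norm_eq_abs, sq_abs]
  have h3 := hf.nondegenerate c hc (μ i)
    (hT.hasEigenvalue_eigenvalues finrank_euclideanSpace_fin i)
  have h4 := h (μ i) (b i) (b.orthonormal.1 i) (hbμ i)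
  have h5 : 2 * m ≤ μ i := by
    rcases lt_abs.1 (hκ.trans h3) with h6 | h6
    · exact h6.le
    · exact absurd (by linarith) h4
  nlinarith [sq_nonneg ⟪b i, v⟫]

/-- Near a saddle there is a critical direction of strongly negative curvature. -/
theorem IsAdmissible.exists_neg_eigenvector (hf : IsAdmissible M L κ f) (hL : 0 < L) (hm : 0 < m)
    (hκ : 2 * m < κ) {c x : E n} (hc : ∇ f c = 0) (hx : ‖x - c‖ ≤ m / L)
    (h : HasNegativeCurvature f x) :
    ∃ (t : ℝ) (v : E n), ‖v‖ = 1 ∧ hessian f c v = t • v ∧ t < -(2 * m) := by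
  by_contra hcon
  push Not at hcon
  obtain ⟨v, hv⟩ := h
  have h1 := hf.inner_hessian_ge_of_no_neg_eigenvalue hκ hc
    (fun t v h1 h2 => not_lt.2 (hcon t v h1 h2)) v
  have h2 := abs_le.1 (hf.abs_inner_hessian_sub_le x c v)
  have h3 : L * ‖x - c‖ ≤ m := (le_div_iff₀' hL).1 hx
  nlinarith [sq_nonneg ‖v‖]

/-- Without negative curvature at a nearby point, the critical Hessian is positive definite. -/
theorem IsAdmissible.inner_hessian_ge_of_not_hasNegativeCurvature (hf : IsAdmissible M L κ f)
    (hL : 0 < L) (hm : 0 < m) (hκ : 2 * m < κ) {c x : E n} (hc : ∇ f c = 0)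
    (hx : ‖x - c‖ ≤ m / L) (h : ¬ HasNegativeCurvature f x) (v : E n) :
    2 * m * ‖v‖ ^ 2 ≤ ⟪hessian f c v, v⟫ := by
  refine hf.inner_hessian_ge_of_no_neg_eigenvalue hκ hc (fun t w hw hwt ht => h ⟨w, ?_⟩) v
  have h2 := abs_le.1 (hf.abs_inner_hessian_sub_le x c w)
  have h3 : L * ‖x - c‖ ≤ m := (le_div_iff₀' hL).1 hx
  rw [hwt, real_inner_smul_left, real_inner_self_eq_norm_sq, hw] at h2
  nlinarith

theorem IsAdmissible.isLocalMin_of_inner_hessian_ge (hf : IsAdmissible M L κ f) (hL : 0 < L)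
    (hm : 0 < m) {c : E n} (hc : ∇ f c = 0)
    (h : ∀ v, 2 * m * ‖v‖ ^ 2 ≤ ⟪hessian f c v, v⟫) : IsLocalMin f c := by
  have hball : Metric.ball c (m / L) ∈ nhds c := Metric.ball_mem_nhds _ (by positivity)
  filter_upwards [hball] with y hy
  set d := y - c with hd
  have hdn : L * ‖d‖ ≤ m := by
    have : ‖d‖ ≤ m / L := by simpa [hd, dist_eq_norm] using hy.le
    exact (le_div_iff₀' hL).1 this
  have key := le_add_of_deriv_le_quadratic (φ := fun s : ℝ => -f (c + s • d))
    (a := 0) (b := 0) (c := 0)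
    (fun s => (hf.hasDerivAt_comp_line c d s).neg)
    (fun s hs => by
      have h1 : |⟪∇ f (c + s • d) - ∇ f c - hessian f c (s • d), d⟫| ≤
          L * (s * ‖d‖) ^ 2 * ‖d‖ := by
        refine (abs_real_inner_le_norm _ _).trans
          (mul_le_mul_of_nonneg_right ?_ (norm_nonneg _))
        have h2 := hf.norm_gradient_sub_sub_le hL.le c (c + s • d)
        rw [add_sub_cancel_left, norm_smul, Real.norm_of_nonneg hs.1] at h2
        exact h2
      rw [hc, sub_zero, inner_sub_left, map_smul, real_inner_smul_left, abs_le] at h1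
      have h3 := mul_le_mul_of_nonneg_left (h d) hs.1
      have h4 : L * (s * ‖d‖) ^ 2 * ‖d‖ ≤ s * (m * ‖d‖ ^ 2) := by
        calc L * (s * ‖d‖) ^ 2 * ‖d‖ = (L * ‖d‖) * (s * s) * ‖d‖ ^ 2 := by ring
          _ ≤ m * (s * 1) * ‖d‖ ^ 2 := by
              have := hs.1
              have := hs.2
              gcongr
          _ = _ := by ring
      have h5 : 0 ≤ s * (m * ‖d‖ ^ 2) := by have := hs.1; positivity
      linarith [h1.1])
  have hcd : c + d = y := by simp [hd]
  simp only [one_smul, zero_smul, add_zero, zero_div, hcd] at key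
  linarith

/-- The stopping criterion certifies a second-order point and a nearby local minimizer. -/
theorem IsAdmissible.conclusion_of_not_hasNegativeCurvature (hf : IsAdmissible M L κ f)
    (hL : 0 < L) (hm : 0 < m) (hκ : 2 * m < κ) {c x : E n} (hc : ∇ f c = 0)
    (hx : ‖x - c‖ ≤ m / L) (h : ¬ HasNegativeCurvature f x) :
    (∀ v : E n, v ≠ 0 → 0 < ⟪hessian f x v, v⟫) ∧ IsLocalMin f c ∧
      m * ‖x - c‖ ≤ ‖∇ f x‖ := by
  have hpos := hf.inner_hessian_ge_of_not_hasNegativeCurvature hL hm hκ hc hx h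
  refine ⟨fun v hv => ?_, hf.isLocalMin_of_inner_hessian_ge hL hm hc hpos,
    hf.mul_norm_sub_le hL hm hκ hc hx⟩
  have h2 := abs_le.1 (hf.abs_inner_hessian_sub_le x c v)
  have h3 : L * ‖x - c‖ ≤ m := (le_div_iff₀' hL).1 hx
  have h4 : 0 < ‖v‖ ^ 2 := by positivity
  nlinarith [hpos v]

end Objective

/-! ### The truncated inverse of a symmetric operator -/

theorem truncAbs_eq_max (m t : ℝ) : truncAbs m t = max |t| m := by
  rw [truncAbs, max_def]
  split_ifs with h1 h2 h2
  · exact le_antisymm h2 h1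
  · rfl
  · rfl
  · exact absurd (not_le.1 h1).le h2

section PTInverse

variable {n : ℕ} {M m : ℝ} {T : E n →L[ℝ] E n}

theorem inner_eigenvectorBasis_ptInverse (h : (T : E n →ₗ[ℝ] E n).IsSymmetric) (v : E n)
    (i : Fin n) :
    ⟪h.eigenvectorBasis finrank_euclideanSpace_fin i, ptInverse m T v⟫ =
      (truncAbs m (h.eigenvalues finrank_euclideanSpace_fin i))⁻¹ *
        ⟪h.eigenvectorBasis finrank_euclideanSpace_fin i, v⟫ := by
  rw [ptInverse, dif_pos h]
  exact (h.eigenvectorBasis finrank_euclideanSpace_fin).orthonormal.inner_right_fintype _ i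

theorem abs_eigenvalues_le (h : (T : E n →ₗ[ℝ] E n).IsSymmetric) (hT : ‖T‖ ≤ M) (i : Fin n) :
    |h.eigenvalues finrank_euclideanSpace_fin i| ≤ M := by
  have h1 := T.le_opNorm (h.eigenvectorBasis finrank_euclideanSpace_fin i)
  have h2 := h.apply_eigenvectorBasis finrank_euclideanSpace_fin i
  rw [ContinuousLinearMap.coe_coe] at h2
  rw [h2, norm_smul, (h.eigenvectorBasis finrank_euclideanSpace_fin).orthonormal.1 i, mul_one,
    mul_one] at h1
  exact h1.trans hT

theorem mul_norm_ptInverse_sq_le (h : (T : E n →ₗ[ℝ] E n).IsSymmetric) (hm : 0 < m) (v : E n) :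
    m * ‖ptInverse m T v‖ ^ 2 ≤ ⟪v, ptInverse m T v⟫ := by
  set b := h.eigenvectorBasis finrank_euclideanSpace_fin with hb
  rw [← b.sum_sq_norm_inner_right, Finset.mul_sum, ← b.sum_inner_mul_inner]
  refine Finset.sum_le_sum fun i _ => ?_
  rw [inner_eigenvectorBasis_ptInverse h, ← hb, real_inner_comm v, Real.norm_eq_abs, sq_abs,
    truncAbs_eq_max]
  set μ := h.eigenvalues finrank_euclideanSpace_fin i
  have h1 : m ≤ max |μ| m := le_max_right _ _
  have h2 : m * (max |μ| m)⁻¹ ≤ 1 := by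
    rw [← div_eq_mul_inv]; exact (div_le_one (hm.trans_le h1)).2 h1
  have h3 : 0 ≤ (max |μ| m)⁻¹ * ⟪v, b i⟫ ^ 2 := by
    have := hm.trans_le h1; positivity
  calc m * ((max |μ| m)⁻¹ * ⟪v, b i⟫) ^ 2
      = m * (max |μ| m)⁻¹ * ((max |μ| m)⁻¹ * ⟪v, b i⟫ ^ 2) := by ring
    _ ≤ 1 * ((max |μ| m)⁻¹ * ⟪v, b i⟫ ^ 2) := mul_le_mul_of_nonneg_right h2 h3
    _ = _ := by ring

theorem norm_sq_le_max_mul_inner_ptInverse (h : (T : E n →ₗ[ℝ] E n).IsSymmetric) (hm : 0 < m)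
    (hT : ‖T‖ ≤ M) (v : E n) : ‖v‖ ^ 2 ≤ max M m * ⟪v, ptInverse m T v⟫ := by
  set b := h.eigenvectorBasis finrank_euclideanSpace_fin with hb
  rw [← b.sum_sq_norm_inner_right, ← b.sum_inner_mul_inner, Finset.mul_sum]
  refine Finset.sum_le_sum fun i _ => ?_
  rw [inner_eigenvectorBasis_ptInverse h, real_inner_comm, Real.norm_eq_abs, sq_abs,
    truncAbs_eq_max]
  set μ := h.eigenvalues finrank_euclideanSpace_fin i with hμ
  have h0 : 0 < max |μ| m := hm.trans_le (le_max_right _ _)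
  have h1 : max |μ| m ≤ max M m := max_le_max (abs_eigenvalues_le h hT i) le_rfl
  have h2 : 1 ≤ max M m * (max |μ| m)⁻¹ := by
    rw [← div_eq_mul_inv]; exact (one_le_div h0).2 h1
  nlinarith [sq_nonneg ⟪b i, v⟫]

theorem mul_norm_ptInverse_le (h : (T : E n →ₗ[ℝ] E n).IsSymmetric) (hm : 0 < m) (v : E n) :
    m * ‖ptInverse m T v‖ ≤ ‖v‖ := by
  have h1 := mul_norm_ptInverse_sq_le h hm v
  have h2 := real_inner_le_norm v (ptInverse m T v)
  rcases (norm_nonneg (ptInverse m T v)).eq_or_lt with h0 | h0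
  · rw [← h0, mul_zero]; exact norm_nonneg _
  · exact le_of_mul_le_mul_right (by nlinarith) h0

theorem pow_apply_of_apply_eq_smul {t : ℝ} {u : E n} (hu : T u = t • u) (k : ℕ) :
    (T ^ k) u = t ^ k • u := by
  induction k with
  | zero => simp
  | succ k ih =>
    rw [pow_succ, ContinuousLinearMap.mul_def, ContinuousLinearMap.comp_apply, hu, map_smul, ih,
      smul_smul, pow_succ, mul_comm]

theorem aeval_apply_of_apply_eq_smul {t : ℝ} {u : E n} (hu : T u = t • u)
    (p : Polynomial ℝ) : (Polynomial.aeval T p) u = p.eval t • u := by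
  rw [Polynomial.aeval_eq_sum_range, Polynomial.eval_eq_sum_range, Finset.sum_smul]
  rw [sum_apply]
  refine Finset.sum_congr rfl fun k _ => ?_
  rw [smul_apply, pow_apply_of_apply_eq_smul hu, smul_smul]

/-- A polynomial that approximates the truncated reciprocal on the spectrum approximates the
truncated inverse in operator norm. -/
theorem norm_aeval_apply_sub_ptInverse_le (h : (T : E n →ₗ[ℝ] E n).IsSymmetric) (hT : ‖T‖ ≤ M)
    {η : ℝ} (hη : 0 ≤ η) {p : Polynomial ℝ}
    (hp : ∀ t ∈ Icc (-M) M, |p.eval t - (truncAbs m t)⁻¹| ≤ η) (v : E n) :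
    ‖(Polynomial.aeval T p) v - ptInverse m T v‖ ≤ η * ‖v‖ := by
  set b := h.eigenvectorBasis finrank_euclideanSpace_fin with hb
  set μ := h.eigenvalues finrank_euclideanSpace_fin with hμ
  refine le_of_sq_le_sq ?_ (by positivity)
  rw [mul_pow, ← b.sum_sq_norm_inner_right, ← b.sum_sq_norm_inner_right v, Finset.mul_sum]
  refine Finset.sum_le_sum fun i _ => ?_
  have hbμ : ∀ i, T (b i) = μ i • b i := fun i => by
    have := h.apply_eigenvectorBasis finrank_euclideanSpace_fin i
    rw [ContinuousLinearMap.coe_coe] at this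
    rw [hb, this]
    rfl
  have h1 : ⟪b i, (Polynomial.aeval T p) v⟫ = p.eval (μ i) * ⟪b i, v⟫ := by
    conv_lhs => rw [← b.sum_repr' v, map_sum]
    simp_rw [map_smul, aeval_apply_of_apply_eq_smul (hbμ _), smul_smul]
    rw [b.orthonormal.inner_right_fintype, mul_comm]
  rw [inner_sub_right, h1, inner_eigenvectorBasis_ptInverse h, ← sub_mul, norm_mul, mul_pow]
  refine mul_le_mul_of_nonneg_right ?_ (by positivity)
  exact pow_le_pow_left₀ (norm_nonneg _) (hp _ (abs_le.1 (abs_eigenvalues_le h hT i))) 2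

end PTInverse

/-! ### The line search -/

/-- The decrease of the objective in one Newton step is at least this constant times the squared
norm of the gradient. -/
noncomputable def decreaseConst (M m α β : ℝ) : ℝ := α * min 1 (β * (m / M)) / max M m

theorem decreaseConst_pos {M m α β : ℝ} (hM : 0 < M) (hm : 0 < m) (hα : 0 < α) (hβ : 0 < β) :
    0 < decreaseConst M m α β := by
  have : 0 < max M m := lt_max_of_lt_left hM
  have : 0 < min 1 (β * (m / M)) := lt_min one_pos (by positivity)
  unfold decreaseConst
  positivity

section NewtonStep

variable {n : ℕ} {f : E n → ℝ} {M L m κ α β : ℝ}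

/-- The sufficient decrease condition tested by the line search. -/
def SufficientDecrease (m α β : ℝ) (f : E n → ℝ) (x : E n) (j : ℕ) : Prop :=
  f (x + β ^ j • direction m f x) ≤ f x + α * β ^ j * ⟪∇ f x, direction m f x⟫

theorem IsAdmissible.sufficientDecrease (hf : IsAdmissible M L κ f) (hM : 0 < M) (hm : 0 < m)
    (hα : α ≤ 1 / 2) (hβ : 0 < β) (x : E n) {j : ℕ} (hj : β ^ j ≤ m / M) :
    SufficientDecrease m α β f x j := by
  have hT := hessian_isSymmetric hf.contDiff x
  have h1 := hf.le_quadratic x (β ^ j • direction m f x)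
  have h2 := mul_norm_ptInverse_sq_le hT hm (∇ f x)
  rw [norm_smul, real_inner_smul_right, Real.norm_of_nonneg (by positivity)] at h1
  simp only [SufficientDecrease, direction, inner_neg_right, norm_neg] at h1 ⊢
  set q := ⟪∇ f x, ptInverse m (hessian f x) (∇ f x)⟫
  set N := ‖ptInverse m (hessian f x) (∇ f x)‖
  have hη : 0 < β ^ j := by positivity
  set η := β ^ j
  have h3 : M * η ≤ m := (le_div_iff₀' hM).1 hj
  have h4 : M / 2 * (η * N) ^ 2 ≤ η * q / 2 := by
    have : M * η * N ^ 2 ≤ q := (mul_le_mul_of_nonneg_right h3 (sq_nonneg N)).trans h2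
    nlinarith
  have hq : 0 ≤ η * q := by
    have : 0 ≤ m * N ^ 2 := by positivity
    have : 0 ≤ q := this.trans h2
    positivity
  nlinarith

theorem IsAdmissible.exists_sufficientDecrease (hf : IsAdmissible M L κ f) (hM : 0 < M)
    (hm : 0 < m) (hα : α ≤ 1 / 2) (hβ : β ∈ Ioo (0 : ℝ) 1) (x : E n) :
    ∃ j, SufficientDecrease m α β f x j := by
  obtain ⟨j, hj⟩ := exists_pow_lt_of_lt_one (div_pos hm hM) hβ.2
  exact ⟨j, hf.sufficientDecrease hM hm hα hβ.1 x hj.le⟩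

theorem IsAdmissible.stepSize_spec (hf : IsAdmissible M L κ f) (hM : 0 < M)
    (hm : 0 < m) (hα : α ≤ 1 / 2) (hβ : β ∈ Ioo (0 : ℝ) 1) (x : E n) :
    min 1 (β * (m / M)) ≤ stepSize m α β f x ∧ stepSize m α β f x ≤ 1 ∧
      f (newtonStep m α β f x) ≤
        f x + α * stepSize m α β f x * ⟪∇ f x, direction m f x⟫ := by
  have hne : {j : ℕ | SufficientDecrease m α β f x j}.Nonempty :=
    hf.exists_sufficientDecrease hM hm hα hβ x
  have hmem := Nat.sInf_mem hne
  refine ⟨?_, pow_le_one₀ hβ.1.le hβ.2.le, hmem⟩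
  change _ ≤ β ^ sInf {j : ℕ | SufficientDecrease m α β f x j}
  rcases Nat.eq_zero_or_eq_succ_pred (sInf {j : ℕ | SufficientDecrease m α β f x j}) with h0 | h0
  · rw [h0, pow_zero]
    exact min_le_left _ _
  -- the previous trial was rejected, so it exceeded `m / M`
  · set k := (sInf {j : ℕ | SufficientDecrease m α β f x j}).pred
    have hk : ¬ SufficientDecrease m α β f x k := fun hk => by
      have := Nat.sInf_le (s := {j : ℕ | SufficientDecrease m α β f x j}) hk
      omega
    have h1 : m / M < β ^ k := by
      by_contra hcon
      exact hk (hf.sufficientDecrease hM hm hα hβ.1 x (not_lt.1 hcon))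
    rw [h0, pow_succ']
    exact (min_le_right _ _).trans (mul_le_mul_of_nonneg_left h1.le hβ.1.le)

theorem IsAdmissible.newtonStep_le (hf : IsAdmissible M L κ f) (hM : 0 < M)
    (hm : 0 < m) (hα : α ∈ Ioo (0 : ℝ) (1 / 2)) (hβ : β ∈ Ioo (0 : ℝ) 1) (x : E n) :
    f (newtonStep m α β f x) ≤ f x - decreaseConst M m α β * ‖∇ f x‖ ^ 2 := by
  obtain ⟨h1, h2, h3⟩ := hf.stepSize_spec hM hm hα.2.le hβ x
  have hT := hessian_isSymmetric hf.contDiff x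
  have h4 := norm_sq_le_max_mul_inner_ptInverse hT hm (hf.norm_hessian_le hM.le x) (∇ f x)
  rw [direction, inner_neg_right] at h3
  have hmax : 0 < max M m := lt_max_of_lt_left hM
  have hmin : 0 < min 1 (β * (m / M)) :=
    lt_min one_pos (mul_pos hβ.1 (div_pos hm hM))
  set q := ⟪∇ f x, ptInverse m (hessian f x) (∇ f x)⟫
  have h5 : ‖∇ f x‖ ^ 2 / max M m ≤ q := (div_le_iff₀' hmax).2 h4
  have h6 : decreaseConst M m α β * ‖∇ f x‖ ^ 2 ≤ α * stepSize m α β f x * q := by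
    calc decreaseConst M m α β * ‖∇ f x‖ ^ 2
        = α * min 1 (β * (m / M)) * (‖∇ f x‖ ^ 2 / max M m) := by rw [decreaseConst]; ring
      _ ≤ α * stepSize m α β f x * q := by
          have := hα.1
          have := hmin.le.trans h1
          gcongr
  linarith

theorem IsAdmissible.mul_norm_newtonStep_sub_le (hf : IsAdmissible M L κ f) (hM : 0 < M)
    (hm : 0 < m) (hα : α ≤ 1 / 2) (hβ : β ∈ Ioo (0 : ℝ) 1) (x : E n) :
    m * ‖newtonStep m α β f x - x‖ ≤ ‖∇ f x‖ := by
  obtain ⟨-, h2, -⟩ := hf.stepSize_spec hM hm hα hβ x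
  have h0 : 0 ≤ stepSize m α β f x := pow_nonneg hβ.1.le _
  have h4 := mul_norm_ptInverse_le (hessian_isSymmetric hf.contDiff x) hm (∇ f x)
  rw [newtonStep, add_sub_cancel_left, norm_smul, Real.norm_of_nonneg h0, direction, norm_neg]
  calc m * (stepSize m α β f x * ‖ptInverse m (hessian f x) (∇ f x)‖)
      ≤ m * (1 * ‖ptInverse m (hessian f x) (∇ f x)‖) := by gcongr
    _ ≤ _ := by rwa [one_mul]

/-! ### Measurability of the iteration -/

/-- The Newton direction is a pointwise limit of continuous fields: by Weierstrass, the truncated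
reciprocal is a uniform limit of polynomials on an interval containing all the spectra. -/
theorem IsAdmissible.measurable_direction (hf : IsAdmissible M L κ f) (hM : 0 < M) (hm : 0 < m) :
    Measurable (direction m f) := by
  have hcont : ContinuousOn (fun t : ℝ => (truncAbs m t)⁻¹) (Icc (-M) M) := by
    simp_rw [truncAbs_eq_max]
    exact ((continuous_abs.max continuous_const).inv₀ fun t =>
      (hm.trans_le (le_max_right _ _)).ne').continuousOn
  have hpoly : ∀ k : ℕ, ∃ p : Polynomial ℝ,
      ∀ t ∈ Icc (-M) M, |p.eval t - (truncAbs m t)⁻¹| < 1 / ((k : ℝ) + 1) := fun k =>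
    exists_polynomial_near_of_continuousOn _ _ _ hcont _ (by positivity)
  choose p hp using hpoly
  have hmeas : Measurable fun x => ptInverse m (hessian f x) (∇ f x) := by
    refine measurable_of_tendsto_metrizable
      (f := fun k x => (Polynomial.aeval (hessian f x) (p k)) (∇ f x)) (fun k => ?_) ?_
    · have h1 : Continuous fun x => Polynomial.aeval (hessian f x) (p k) := by
        simp_rw [Polynomial.aeval_eq_sum_range]
        exact continuous_finsetSum _ fun i _ =>
          (hf.continuous_hessian.pow i).const_smul ((p k).coeff i)
      exact (h1.clm_apply hf.continuous_gradient).measurable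
    · refine tendsto_pi_nhds.2 fun x => ?_
      rw [tendsto_iff_norm_sub_tendsto_zero]
      have h2 : Filter.Tendsto (fun k : ℕ => 1 / ((k : ℝ) + 1) * ‖∇ f x‖) Filter.atTop
          (nhds 0) := by
        simpa using tendsto_one_div_add_atTop_nhds_zero_nat.mul_const ‖∇ f x‖
      refine squeeze_zero (fun k => norm_nonneg _) (fun k => ?_) h2
      exact norm_aeval_apply_sub_ptInverse_le (hessian_isSymmetric hf.contDiff x)
        (hf.norm_hessian_le hM.le x) (by positivity) (fun t ht => (hp k t ht).le) _
  exact hmeas.neg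

theorem IsAdmissible.measurable_newtonStep (hf : IsAdmissible M L κ f) (hM : 0 < M)
    (hm : 0 < m) (hα : α ≤ 1 / 2) (hβ : β ∈ Ioo (0 : ℝ) 1) :
    Measurable (newtonStep m α β f) := by
  have hd := hf.measurable_direction hM hm
  have hfc : Measurable f := hf.contDiff.continuous.measurable
  have hg : Measurable (gradient f) := hf.continuous_gradient.measurable
  have hstep : Measurable (stepSize m α β f) := by
    classical
    have h1 : ∀ x, stepSize m α β f x =
        β ^ Nat.find (hf.exists_sufficientDecrease hM hm hα hβ x) := fun x => by
      change β ^ sInf {j : ℕ | SufficientDecrease m α β f x j} = _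
      congr 1
      convert Nat.sInf_def (s := {j : ℕ | SufficientDecrease m α β f x j})
        (hf.exists_sufficientDecrease hM hm hα hβ x)
    rw [funext h1]
    refine (measurable_from_nat (f := fun j => β ^ j)).comp (measurable_find _ fun k => ?_)
    exact measurableSet_le (hfc.comp (measurable_id.add (hd.const_smul (β ^ k))))
      (hfc.add ((hg.inner hd).const_mul _))
  exact measurable_id.add (hstep.smul hd)

theorem IsAdmissible.measurableSet_hasNegativeCurvature (hf : IsAdmissible M L κ f) :
    MeasurableSet {x | HasNegativeCurvature f x} := by
  simp only [HasNegativeCurvature, ofPred_exists]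
  exact (isOpen_iUnion fun v => isOpen_lt ((hf.continuous_hessian.clm_apply
    continuous_const).inner continuous_const) continuous_const).measurableSet

theorem IsAdmissible.measurable_iterStep {γ ζ ε : ℝ} (hf : IsAdmissible M L κ f) (hM : 0 < M)
    (hm : 0 < m) (hα : α ≤ 1 / 2) (hβ : β ∈ Ioo (0 : ℝ) 1) :
    Measurable fun q : E n × State n => iterStep M m α β γ ζ ε f q.1 q.2 := by
  have hN := hf.measurable_newtonStep hM hm hα hβ
  have hg : Measurable (gradient f) := hf.continuous_gradient.measurable
  have hx : Measurable fun q : E n × State n => q.2.1 := by fun_prop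
  have hr : Measurable fun q : E n × State n => q.2.2 := by fun_prop
  have hs : Measurable fun q : E n × State n => q.2 := by fun_prop
  have hy : Measurable fun q : E n × State n => q.2.1 + q.1 := by fun_prop
  have hpred : Measurable fun q : E n × State n => q.2.2 - 1 :=
    (measurable_from_nat (f := fun r => r - 1)).comp hr
  unfold iterStep
  refine Measurable.ite (hr (measurableSet_Ioi (a := 0))) ((hN.comp hx).prodMk hpred) ?_
  refine Measurable.ite (measurableSet_lt measurable_const (hg.comp hx).norm)
    ((hN.comp hx).prodMk measurable_const) ?_
  refine Measurable.ite (hx hf.measurableSet_hasNegativeCurvature) ?_ hs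
  exact Measurable.ite (measurableSet_le (hg.comp hy).norm measurable_const)
    (hy.prodMk measurable_const) hs

theorem IsAdmissible.measurableSet_stopped {ε : ℝ} (hf : IsAdmissible M L κ f) :
    MeasurableSet {s : State n | Stopped ε f s} := by
  have hg : Measurable (gradient f) := hf.continuous_gradient.measurable
  exact (measurable_snd (measurableSet_singleton 0)).inter
    ((measurableSet_le (hg.comp measurable_fst).norm measurable_const).inter
      (measurable_fst hf.measurableSet_hasNegativeCurvature.compl))

end NewtonStep

/-! ### The potential of the gap to a critical value -/

theorem arsinh_sub_le {y y' : ℝ} (h : y ≤ y') : Real.arsinh y' - Real.arsinh y ≤ y' - y := by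
  have h1 := convex_univ.image_sub_le_mul_sub_of_deriv_le (f := Real.arsinh) (C := 1)
    Real.continuous_arsinh.continuousOn Real.differentiable_arsinh.differentiableOn
    (fun x _ => by
      rw [(Real.hasDerivAt_arsinh x).deriv]
      exact inv_le_one_of_one_le₀ (Real.one_le_sqrt.2 (by nlinarith [sq_nonneg x])))
    y (mem_univ _) y' (mem_univ _) h
  linarith

/-- `arsinh` decreases by a fixed amount when its argument `y` decreases by a fixed fraction of
`1 + |y|`: it is comparable to the signed logarithm of `1 + |y|`. -/
theorem arsinh_sub_mul_le {y t : ℝ} (ht0 : 0 ≤ t) (ht1 : t ≤ 1) :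
    Real.arsinh (y - t * (1 + |y|)) ≤ Real.arsinh y - t / 2 := by
  have hpos : 0 < 1 + |y| := by positivity
  have hle : y - t * (1 + |y|) ≤ y := by nlinarith
  have h1 := (convex_Icc (y - t * (1 + |y|)) y).mul_sub_le_image_sub_of_le_deriv
    (f := Real.arsinh) (C := 1 / (2 * (1 + |y|)))
    Real.continuous_arsinh.continuousOn Real.differentiable_arsinh.differentiableOn
    (fun x hx => by
      rw [interior_Icc] at hx
      rw [(Real.hasDerivAt_arsinh x).deriv, one_div]
      refine inv_anti₀ (Real.sqrt_pos.2 (by positivity)) ?_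
      have h2 : |x| ≤ 1 + 2 * |y| := by
        rw [abs_le]
        have := le_abs_self y
        have := neg_abs_le y
        constructor <;> nlinarith [hx.1, hx.2]
      rw [Real.sqrt_le_left (by positivity)]
      nlinarith [sq_abs x, abs_nonneg x, abs_nonneg y])
    _ (left_mem_Icc.2 hle) _ (right_mem_Icc.2 hle) hle
  have h3 : 1 / (2 * (1 + |y|)) * (y - (y - t * (1 + |y|))) = t / 2 := by
    field_simp
    ring
  linarith

open Classical in
/-- The potential of a gap `u = f x - f c` to a critical value `f c`. The `arsinh` term behaves as
a signed logarithm of `u / ε²`, which changes by a constant when `u` is multiplied by a constant;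
the indicator rewards the event that the objective has passed well below the critical value. -/
noncomputable def gapPotential (b a ε u : ℝ) : ℝ :=
  a * Real.arsinh (u / ε ^ 2) + if -(b * ε ^ 2) < u then 1 else 0

section GapPotential

variable {b a ε u u' : ℝ}

theorem gapPotential_mono (ha : 0 ≤ a) (h : u' ≤ u) :
    gapPotential b a ε u' ≤ gapPotential b a ε u := by
  have h1 : a * Real.arsinh (u' / ε ^ 2) ≤ a * Real.arsinh (u / ε ^ 2) :=
    mul_le_mul_of_nonneg_left (Real.arsinh_le_arsinh.2 (by gcongr)) ha
  unfold gapPotential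
  split_ifs <;> linarith

theorem gapPotential_le_sub (hε : 0 < ε) (ha : 0 ≤ a) {t : ℝ} (ht0 : 0 ≤ t) (ht1 : t ≤ 1)
    (h : u' ≤ u - t * (ε ^ 2 + |u|)) :
    gapPotential b a ε u' ≤ gapPotential b a ε u - a * t / 2 := by
  have hle : u' ≤ u := by
    have : 0 ≤ t * (ε ^ 2 + |u|) := by positivity
    linarith
  have h1 : Real.arsinh (u' / ε ^ 2) ≤ Real.arsinh (u / ε ^ 2) - t / 2 := by
    refine le_trans (Real.arsinh_le_arsinh.2 ?_) (arsinh_sub_mul_le (y := u / ε ^ 2) ht0 ht1)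
    rw [abs_div, abs_of_pos (by positivity : 0 < ε ^ 2)]
    calc u' / ε ^ 2 ≤ (u - t * (ε ^ 2 + |u|)) / ε ^ 2 := by gcongr
      _ = _ := by field_simp
  have h2 := mul_le_mul_of_nonneg_left h1 ha
  unfold gapPotential
  split_ifs <;> linarith

theorem abs_gapPotential_le {K : ℝ} (ha0 : 0 ≤ a) (ha1 : a ≤ 1) (h : |u| ≤ K) :
    |gapPotential b a ε u| ≤ Real.arsinh (K / ε ^ 2) + 1 := by
  have hK : 0 ≤ K := (abs_nonneg u).trans h
  have hA : 0 ≤ Real.arsinh (K / ε ^ 2) := Real.arsinh_nonneg_iff.2 (by positivity)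
  have h1 : Real.arsinh (u / ε ^ 2) ≤ Real.arsinh (K / ε ^ 2) :=
    Real.arsinh_le_arsinh.2 (by have := (abs_le.1 h).2; gcongr)
  have h2 : -Real.arsinh (K / ε ^ 2) ≤ Real.arsinh (u / ε ^ 2) := by
    rw [← Real.arsinh_neg, ← neg_div]
    exact Real.arsinh_le_arsinh.2 (by have := (abs_le.1 h).1; gcongr)
  unfold gapPotential
  rw [abs_le]
  split_ifs <;> constructor <;> nlinarith

theorem mul_arsinh_div_le_add {e : ℝ} (ha : 0 ≤ a) (he : 0 ≤ e) (h : u' ≤ u + e) :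
    a * Real.arsinh (u' / ε ^ 2) ≤ a * Real.arsinh (u / ε ^ 2) + a * (e / ε ^ 2) := by
  have h1 : Real.arsinh (u' / ε ^ 2) ≤ Real.arsinh ((u + e) / ε ^ 2) :=
    Real.arsinh_le_arsinh.2 (by gcongr)
  have h2 := arsinh_sub_le (y := u / ε ^ 2) (y' := (u + e) / ε ^ 2)
    (by gcongr; linarith)
  rw [add_div] at h1 h2
  nlinarith

end GapPotential

/-! ### The potential of a state -/

/-- The hypotheses on the objective and the parameters, with a gradient level `d` so low that points with gradient at
most `d` are much closer to a critical point than critical points are to each other. -/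
structure Landscape {n : ℕ} (M L m α β κ d : ℝ) (f : E n → ℝ) : Prop where
  admissible : IsAdmissible M L κ f
  M_pos : 0 < M
  L_pos : 0 < L
  m_pos : 0 < m
  two_mul_lt : 2 * m < κ
  α_mem : α ∈ Ioo (0 : ℝ) (1 / 2)
  β_mem : β ∈ Ioo (0 : ℝ) 1
  d_pos : 0 < d
  d_le : d ≤ m ^ 2 / (2 * L)
  exists_critical : ∀ x, ‖∇ f x‖ ≤ d → ∃ c, ∇ f c = 0 ∧ ‖x - c‖ < m / L

open Classical in
/-- The gap potential relative to the critical point near `x` if the gradient at `x` is small;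
zero elsewhere. -/
noncomputable def localPotential {n : ℕ} (M L m d a ε : ℝ) (f : E n → ℝ) (x : E n) : ℝ :=
  if h : ‖∇ f x‖ ≤ d ∧ ∃ c, ∇ f c = 0 ∧ ‖x - c‖ < m / L then
    gapPotential (M / m ^ 2) a ε (f x - f h.2.choose)
  else 0

/-- A bound for the local potential; it grows like `log (1 / ε)`. -/
noncomputable def localBound (M m d ε : ℝ) : ℝ :=
  Real.arsinh (M / (2 * m ^ 2) * d ^ 2 / ε ^ 2) + 1

/-- The potential of the iterate `x`: the weight `θ`, of order `log (1 / ε)`, makes a step with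
large gradient pay for any change of the local potential. -/
noncomputable def pointPotential {n : ℕ} (M L m d a ε θ : ℝ) (f : E n → ℝ) (x : E n) : ℝ :=
  θ * f x + localPotential M L m d a ε f x

/-- The fraction of `ε² + |f x - f c|` by which a Newton step decreases `f` near a critical
point `c`, as long as the gradient exceeds `ε`. -/
noncomputable def gapRate (M m α β : ℝ) : ℝ :=
  min 1 (decreaseConst M m α β / 2 * min 1 (2 * m ^ 2 / M))

section Landscape

variable {n : ℕ} {f : E n → ℝ} {M L m α β κ d a ε θ : ℝ}

theorem one_le_localBound (hM : 0 ≤ M) : 1 ≤ localBound M m d ε := by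
  have : 0 ≤ Real.arsinh (M / (2 * m ^ 2) * d ^ 2 / ε ^ 2) :=
    Real.arsinh_nonneg_iff.2 (by positivity)
  unfold localBound
  linarith

theorem gapRate_pos (hM : 0 < M) (hm : 0 < m) (hα : 0 < α) (hβ : 0 < β) :
    0 < gapRate M m α β := by
  have := decreaseConst_pos hM hm hα hβ
  have : 0 < min 1 (2 * m ^ 2 / M) := lt_min one_pos (by positivity)
  exact lt_min one_pos (by positivity)

theorem Landscape.norm_sub_critical_le (h : Landscape M L m α β κ d f) {c x : E n} (hc : ∇ f c = 0)
    (hxc : ‖x - c‖ ≤ m / L) (hx : ‖∇ f x‖ ≤ d) : ‖x - c‖ ≤ m / L / 2 := by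
  have h1 := h.admissible.mul_norm_sub_le h.L_pos h.m_pos h.two_mul_lt hc hxc
  have hm := h.m_pos
  have hL := h.L_pos
  have h2 : m * ‖x - c‖ ≤ m * (m / L / 2) := by
    calc m * ‖x - c‖ ≤ m ^ 2 / (2 * L) := h1.trans (hx.trans h.d_le)
      _ = m * (m / L / 2) := by field_simp
  exact le_of_mul_le_mul_left h2 hm

/-- Two points with small gradients at distance less than `m / L` share their critical point. -/
theorem Landscape.localPotential_eq (h : Landscape M L m α β κ d f) {c x y : E n}
    (hc : ∇ f c = 0) (hxc : ‖x - c‖ ≤ m / L) (hx : ‖∇ f x‖ ≤ d) (hy : ‖∇ f y‖ ≤ d)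
    (hyx : ‖y - x‖ < m / L) :
    localPotential M L m d a ε f y = gapPotential (M / m ^ 2) a ε (f y - f c) := by
  have hex : ‖∇ f y‖ ≤ d ∧ ∃ c, ∇ f c = 0 ∧ ‖y - c‖ < m / L := ⟨hy, h.exists_critical y hy⟩
  obtain ⟨h1, h2⟩ := hex.2.choose_spec
  have h3 := h.norm_sub_critical_le h1 h2.le hy
  have h4 := h.norm_sub_critical_le hc hxc hx
  have h5 : ‖hex.2.choose - c‖ < 2 * (m / L) := by
    calc ‖hex.2.choose - c‖ = ‖(x - c) + (y - x) - (y - hex.2.choose)‖ := by congr 1; abel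
      _ ≤ ‖x - c‖ + ‖y - x‖ + ‖y - hex.2.choose‖ :=
        (norm_sub_le _ _).trans (by gcongr; exact norm_add_le _ _)
      _ < _ := by linarith
  have h6 := h.admissible.eq_of_norm_sub_lt h.L_pos h.m_pos h.two_mul_lt hc h1 h5
  rw [localPotential, dif_pos hex, h6]

theorem Landscape.localPotential_eq_self (h : Landscape M L m α β κ d f) {c x : E n}
    (hc : ∇ f c = 0) (hxc : ‖x - c‖ ≤ m / L) (hx : ‖∇ f x‖ ≤ d) :
    localPotential M L m d a ε f x = gapPotential (M / m ^ 2) a ε (f x - f c) :=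
  h.localPotential_eq hc hxc hx hx (by
    rw [sub_self, norm_zero]; exact div_pos h.m_pos h.L_pos)

theorem Landscape.abs_localPotential_le (h : Landscape M L m α β κ d f) (ha0 : 0 ≤ a)
    (ha1 : a ≤ 1) (x : E n) : |localPotential M L m d a ε f x| ≤ localBound M m d ε := by
  by_cases hx : ‖∇ f x‖ ≤ d
  · obtain ⟨c, hc, hxc⟩ := h.exists_critical x hx
    rw [h.localPotential_eq_self hc hxc.le hx]
    refine abs_gapPotential_le ha0 ha1 ?_
    refine (h.admissible.abs_sub_critical_le_norm_gradient h.M_pos.le h.L_pos h.m_pos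
      h.two_mul_lt hc hxc.le).trans ?_
    have := h.M_pos
    gcongr
  · rw [localPotential, dif_neg (fun hh => hx hh.1), abs_zero]
    exact zero_le_one.trans (one_le_localBound h.M_pos.le)

/-- A Newton step does not increase the potential, and decreases it by a constant while the
gradient exceeds `ε`. Away from critical points this is the decrease of `f`; near a critical
point `c` it is the decrease of the gap `f x - f c`, which is geometric on either side of zero. -/
theorem Landscape.pointPotential_newtonStep_le (h : Landscape M L m α β κ d f) (hε : 0 < ε)
    (ha0 : 0 ≤ a) (ha1 : a ≤ 1) (hθ0 : 0 ≤ θ)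
    (hθ : 3 * localBound M m d ε ≤ θ * (decreaseConst M m α β * (d / (1 + M / m)) ^ 2))
    (x : E n) :
    pointPotential M L m d a ε θ f (newtonStep m α β f x) ≤ pointPotential M L m d a ε θ f x ∧
    (ε < ‖∇ f x‖ → pointPotential M L m d a ε θ f (newtonStep m α β f x) ≤
      pointPotential M L m d a ε θ f x - min 1 (a * gapRate M m α β / 2)) := by
  have hf := h.admissible
  have hM := h.M_pos
  have hm := h.m_pos
  have hL := h.L_pos
  set c₁ := decreaseConst M m α β with hc₁
  have hc₁0 : 0 < c₁ := decreaseConst_pos hM hm h.α_mem.1 h.β_mem.1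
  set x' := newtonStep m α β f x with hx'
  have hdec : f x' ≤ f x - c₁ * ‖∇ f x‖ ^ 2 := hf.newtonStep_le hM hm h.α_mem h.β_mem x
  have hstep : m * ‖x' - x‖ ≤ ‖∇ f x‖ :=
    hf.mul_norm_newtonStep_sub_le hM hm h.α_mem.2.le h.β_mem x
  have hdM : 0 < 1 + M / m := by positivity
  have hd := h.d_pos
  have hθf : θ * f x' ≤ θ * f x - θ * (c₁ * ‖∇ f x‖ ^ 2) := by
    have := mul_le_mul_of_nonneg_left hdec hθ0
    linarith
  unfold pointPotential
  rcases le_or_gt (d / (1 + M / m)) ‖∇ f x‖ with hfar | hnear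
  · have h1 := abs_le.1 (h.abs_localPotential_le (ε := ε) ha0 ha1 x)
    have h2 := abs_le.1 (h.abs_localPotential_le (ε := ε) ha0 ha1 x')
    have h3 : θ * (c₁ * (d / (1 + M / m)) ^ 2) ≤ θ * (c₁ * ‖∇ f x‖ ^ 2) := by gcongr
    have h4 := one_le_localBound (M := M) (m := m) (d := d) (ε := ε) hM.le
    have h5 := min_le_left 1 (a * gapRate M m α β / 2)
    constructor
    · linarith
    · intro _
      linarith
  · have hx : ‖∇ f x‖ ≤ d := by
      refine hnear.le.trans (div_le_self hd.le ?_)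
      have : 0 ≤ M / m := by positivity
      linarith
    have hxg' : ‖∇ f x'‖ ≤ d := by
      have h1 := hf.gradient_lipschitz x' x
      have h2 : M * ‖x' - x‖ ≤ M / m * ‖∇ f x‖ := by
        calc M * ‖x' - x‖ = M / m * (m * ‖x' - x‖) := by field_simp
          _ ≤ _ := by gcongr
      have h3 := norm_sub_norm_le (∇ f x') (∇ f x)
      have h4 : ‖∇ f x‖ * (1 + M / m) ≤ d := ((lt_div_iff₀ hdM).1 hnear).le
      nlinarith
    obtain ⟨c, hc, hxc⟩ := h.exists_critical x hx
    have hmL : 0 < m / L := by positivity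
    have hxx : ‖x' - x‖ < m / L := by
      have h1 : m * ‖x' - x‖ ≤ m * (m / L / 2) := by
        calc m * ‖x' - x‖ ≤ m ^ 2 / (2 * L) := hstep.trans (hx.trans h.d_le)
          _ = m * (m / L / 2) := by field_simp
      have := le_of_mul_le_mul_left h1 hm
      linarith
    rw [h.localPotential_eq_self hc hxc.le hx, h.localPotential_eq hc hxc.le hx hxg' hxx]
    have hθ1 : 0 ≤ θ * (c₁ * ‖∇ f x‖ ^ 2) := by positivity
    constructor
    · have h1 : f x' - f c ≤ f x - f c := by
        have : 0 ≤ c₁ * ‖∇ f x‖ ^ 2 := by positivity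
        linarith
      have := gapPotential_mono (b := M / m ^ 2) (ε := ε) ha0 h1
      linarith
    · intro hεx
      have hg : |f x - f c| ≤ M / (2 * m ^ 2) * ‖∇ f x‖ ^ 2 :=
        hf.abs_sub_critical_le_norm_gradient hM.le hL hm h.two_mul_lt hc hxc.le
      have hr0 := (gapRate_pos hM hm h.α_mem.1 h.β_mem.1).le
      have hr1 : gapRate M m α β ≤ 1 := min_le_left _ _
      have hr2 : gapRate M m α β ≤ c₁ / 2 * min 1 (2 * m ^ 2 / M) := min_le_right _ _
      have hr3 : gapRate M m α β ≤ c₁ / 2 :=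
        hr2.trans (mul_le_of_le_one_right (by positivity) (min_le_left _ _))
      have hr4 : gapRate M m α β ≤ c₁ / 2 * (2 * m ^ 2 / M) :=
        hr2.trans (mul_le_mul_of_nonneg_left (min_le_right _ _) (by positivity))
      have h1 : gapRate M m α β * ε ^ 2 ≤ c₁ / 2 * ‖∇ f x‖ ^ 2 := by gcongr
      have h2 : gapRate M m α β * |f x - f c| ≤ c₁ / 2 * ‖∇ f x‖ ^ 2 := by
        calc gapRate M m α β * |f x - f c|
            ≤ c₁ / 2 * (2 * m ^ 2 / M) * (M / (2 * m ^ 2) * ‖∇ f x‖ ^ 2) := by gcongr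
          _ = _ := by field_simp
      have h3 := gapPotential_le_sub (b := M / m ^ 2) (u := f x - f c) (u' := f x' - f c)
        hε ha0 hr0 hr1 (by linarith)
      have h4 := min_le_right 1 (a * gapRate M m α β / 2)
      linarith

/-! ### The effect of the noise -/

/-- After a displacement by `X` from a point near a saddle, the potential has grown by at most a
quadratic function of `X / ε`, and by one less if the objective has dropped well below the critical
value. -/
theorem Landscape.pointPotential_add_le (h : Landscape M L m α β κ d f) (hε : 0 < ε) (hεd : ε ≤ d)
    (ha0 : 0 ≤ a) (ha1 : a ≤ 1) (hθ0 : 0 ≤ θ) {c x X : E n} (hc : ∇ f c = 0)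
    (hxc : ‖x - c‖ < m / L) (hx : ‖∇ f x‖ ≤ ε) (hX : ‖∇ f (x + X)‖ ≤ d) :
    pointPotential M L m d a ε θ f (x + X) ≤ pointPotential M L m d a ε θ f x +
        (θ + a / ε ^ 2) * (ε * ‖X‖ + M / 2 * ‖X‖ ^ 2) +
        2 * localBound M m d ε * (L / m) ^ 2 * ‖X‖ ^ 2 ∧
    (‖X‖ < m / L → f (x + X) ≤ f c - M / m ^ 2 * ε ^ 2 →
      pointPotential M L m d a ε θ f (x + X) ≤ pointPotential M L m d a ε θ f x +
        (θ + a / ε ^ 2) * (ε * ‖X‖ + M / 2 * ‖X‖ ^ 2) - 1) := by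
  have hf := h.admissible
  have hM := h.M_pos
  have hm := h.m_pos
  have hL := h.L_pos
  have hxd : ‖∇ f x‖ ≤ d := hx.trans hεd
  set e := ε * ‖X‖ + M / 2 * ‖X‖ ^ 2 with he
  have he0 : 0 ≤ e := by positivity
  have hfe : f (x + X) ≤ f x + e := by
    have h1 := hf.le_quadratic x X
    have h2 : ⟪∇ f x, X⟫ ≤ ε * ‖X‖ := (real_inner_le_norm _ _).trans (by gcongr)
    linarith
  have hθe : θ * f (x + X) ≤ θ * f x + θ * e := by
    have := mul_le_mul_of_nonneg_left hfe hθ0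
    linarith
  have hu : -(M / m ^ 2 * ε ^ 2) < f x - f c := by
    have h1 := (abs_le.1 (hf.abs_sub_critical_le_norm_gradient hM.le hL hm h.two_mul_lt hc
      hxc.le)).1
    have h2 : M / (2 * m ^ 2) * ‖∇ f x‖ ^ 2 ≤ M / (2 * m ^ 2) * ε ^ 2 := by gcongr
    have h3 : 0 < M / (2 * m ^ 2) * ε ^ 2 := by positivity
    have h4 : M / m ^ 2 * ε ^ 2 = 2 * (M / (2 * m ^ 2) * ε ^ 2) := by field_simp
    linarith
  have hlocx : localPotential M L m d a ε f x =
      a * Real.arsinh ((f x - f c) / ε ^ 2) + 1 := by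
    rw [h.localPotential_eq_self hc hxc.le hxd, gapPotential, if_pos hu]
  have harsinh : a * Real.arsinh ((f (x + X) - f c) / ε ^ 2) ≤
      a * Real.arsinh ((f x - f c) / ε ^ 2) + a * (e / ε ^ 2) :=
    mul_arsinh_div_le_add ha0 he0 (by linarith)
  have hae : (θ + a / ε ^ 2) * e = θ * e + a * (e / ε ^ 2) := by ring
  have hΛ := one_le_localBound (M := M) (m := m) (d := d) (ε := ε) hM.le
  have hXX : x + X - x = X := add_sub_cancel_left _ _
  unfold pointPotential
  constructor
  · rcases lt_or_ge ‖X‖ (m / L) with hlt | hge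
    · have h1 := h.localPotential_eq (a := a) (ε := ε) hc hxc.le hxd hX (by rwa [hXX])
      have h2 : localPotential M L m d a ε f (x + X) ≤
          a * Real.arsinh ((f (x + X) - f c) / ε ^ 2) + 1 := by
        rw [h1, gapPotential]
        split_ifs <;> linarith
      have h3 : 0 ≤ 2 * localBound M m d ε * (L / m) ^ 2 * ‖X‖ ^ 2 := by positivity
      linarith
    · have h1 := abs_le.1 (h.abs_localPotential_le (ε := ε) ha0 ha1 x)
      have h2 := abs_le.1 (h.abs_localPotential_le (ε := ε) ha0 ha1 (x + X))
      have h3 : 1 ≤ (L / m) ^ 2 * ‖X‖ ^ 2 := by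
        rw [← mul_pow]
        refine one_le_pow₀ ?_
        calc (1 : ℝ) = L / m * (m / L) := by field_simp
          _ ≤ L / m * ‖X‖ := by gcongr
      have h4 : 0 ≤ a * (e / ε ^ 2) := by positivity
      nlinarith
  · intro hlt hdrop
    have h1 := h.localPotential_eq (a := a) (ε := ε) hc hxc.le hxd hX (by rwa [hXX])
    rw [h1, gapPotential, if_neg (not_lt.2 (by linarith))]
    linarith

/-- Near a saddle `c`, a ball of noise vectors, of radius and distance to the origin proportional
to `ε`, leads well below the critical value while the gradient remains of order `ε`. It is centred
on the vector leading to `c + t v` with `v` a direction of negative curvature. -/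
theorem Landscape.exists_good_ball (h : Landscape M L m α β κ d f) (hε : 0 < ε)
    (hε1 : 8 * (L * M ^ 2 / m ^ 4 * ε) ≤ 1) (hε2 : 8 * (L * M ^ 2 / m ^ 4 * ε) ≤ M / m)
    {c x : E n} (hc : ∇ f c = 0) (hxc : ‖x - c‖ < m / L) (hx : ‖∇ f x‖ ≤ ε)
    (hneg : HasNegativeCurvature f x) :
    ∃ X₀ : E n, ‖X₀‖ ≤ (1 / m + M / m ^ 2) * ε ∧ ∀ X : E n, ‖X - X₀‖ ≤ ε / (8 * M) →
      ‖∇ f (x + X)‖ ≤ (2 * (M / m) + 1) * ε ∧ f (x + X) ≤ f c - M / m ^ 2 * ε ^ 2 := by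
  have hf := h.admissible
  have hM := h.M_pos
  have hm := h.m_pos
  have hL := h.L_pos
  obtain ⟨t, v, hv, htv, ht⟩ := hf.exists_neg_eigenvector hL hm h.two_mul_lt hc hxc.le hneg
  -- the length of the displacement along `v` is chosen so that the gradient has norm `2 (M / m) ε`
  set μ := -t with hμ
  have hμm : 2 * m < μ := by linarith
  have hμ0 : 0 < μ := by linarith
  have hμM : μ ≤ M := by
    have h1 := (hessian f c).le_opNorm v
    rw [htv, norm_smul, hv, mul_one, mul_one, Real.norm_eq_abs, abs_of_neg (by linarith)] at h1
    exact h1.trans (hf.norm_hessian_le hM.le c)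
  set s := 2 * (M / m) * ε / μ with hs
  have hs0 : 0 < s := by positivity
  have hsμ : μ * s = 2 * (M / m) * ε := by rw [hs]; field_simp
  have hsle : s ≤ M / m ^ 2 * ε := by
    rw [hs, div_le_iff₀ hμ0]
    calc 2 * (M / m) * ε = M / m ^ 2 * ε * (2 * m) := by field_simp
      _ ≤ M / m ^ 2 * ε * μ := by gcongr
  have hLs : L * s ^ 2 ≤ (L * M ^ 2 / m ^ 4 * ε) * ε := by
    calc L * s ^ 2 ≤ L * (M / m ^ 2 * ε) ^ 2 := by gcongr
      _ = _ := by field_simp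
  set w := L * M ^ 2 / m ^ 4 * ε with hw
  have hw0 : 0 < w := by positivity
  have hnorm : ‖s • v‖ = s := by rw [norm_smul, hv, mul_one, Real.norm_of_nonneg hs0.le]
  have hgrad : ‖∇ f (c + s • v)‖ ≤ 2 * (M / m) * ε + w * ε := by
    have h1 := hf.norm_gradient_sub_sub_le hL.le c (c + s • v)
    rw [add_sub_cancel_left, hc, sub_zero, hnorm, map_smul, htv, smul_smul] at h1
    have h2 : ‖(s * t) • v‖ = μ * s := by
      rw [norm_smul, hv, mul_one, Real.norm_eq_abs, abs_mul, abs_of_pos hs0,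
        abs_of_neg (by linarith), mul_comm]
    have h3 := norm_sub_norm_le (∇ f (c + s • v)) ((s * t) • v)
    rw [h2, hsμ] at h3
    linarith
  have hval : f (c + s • v) ≤ f c - M / m * ε * s + w * ε * s / 3 := by
    have h1 := hf.le_cubic hL.le hc (s • v)
    have h2 : ⟪hessian f c (s • v), s • v⟫ = -(μ * s) * s := by
      rw [map_smul, htv, smul_smul, real_inner_smul_left, real_inner_smul_right,
        real_inner_self_eq_norm_sq, hv, hμ]
      ring
    rw [h2, hnorm, hsμ] at h1
    have h3 : L / 3 * s ^ 3 ≤ w * ε * s / 3 := by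
      have := mul_le_mul_of_nonneg_right hLs hs0.le
      linarith
    linarith
  have hslow : 2 / m * ε ≤ s := by
    rw [hs, le_div_iff₀ hμ0]
    calc 2 / m * ε * μ ≤ 2 / m * ε * M := by gcongr
      _ = 2 * (M / m) * ε := by ring
  refine ⟨c + s • v - x, ?_, fun X hX => ?_⟩
  · have h1 := hf.mul_norm_sub_le hL hm h.two_mul_lt hc hxc.le
    have h2 : ‖x - c‖ ≤ 1 / m * ε := by
      rw [one_div, ← div_eq_inv_mul, le_div_iff₀' hm]
      linarith
    calc ‖c + s • v - x‖ = ‖s • v - (x - c)‖ := by congr 1; abel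
      _ ≤ s + ‖x - c‖ := (norm_sub_le _ _).trans_eq (by rw [hnorm])
      _ ≤ _ := by linarith
  · set y := X - (c + s • v - x) with hy
    have hxy : x + X = (c + s • v) + y := by rw [hy]; abel
    have hMy : M * ‖y‖ ≤ ε / 8 := by
      calc M * ‖y‖ ≤ M * (ε / (8 * M)) := by gcongr
        _ = ε / 8 := by field_simp
    rw [hxy]
    constructor
    · have h1 := hf.gradient_lipschitz (c + s • v + y) (c + s • v)
      rw [add_sub_cancel_left] at h1
      have h2 := norm_sub_norm_le (∇ f (c + s • v + y)) (∇ f (c + s • v))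
      nlinarith
    · have h1 := hf.le_quadratic (c + s • v) y
      have h2 : ⟪∇ f (c + s • v), y⟫ ≤ (2 * (M / m) * ε + w * ε) * ‖y‖ :=
        (real_inner_le_norm _ _).trans (by gcongr)
      -- `p` is the common unit: the gain is `M / m * ε * s ≥ 2 p`, every loss a fraction of `p`
      set p := M / m ^ 2 * ε ^ 2 with hp
      have hp0 : 0 < p := by positivity
      have hA : 2 * p ≤ M / m * ε * s := by
        calc 2 * p = M / m * ε * (2 / m * ε) := by rw [hp]; field_simp
          _ ≤ _ := by gcongr
      have hB : w * ε * s / 3 ≤ M / m * ε * s / 24 := by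
        have : 8 * w * (ε * s) ≤ M / m * (ε * s) := by gcongr
        linarith
      have hMm : 2 * m ≤ M := by linarith
      have hy1 : ‖y‖ ≤ ε / (8 * M) := hX
      have hC : (2 * (M / m) * ε + w * ε) * ‖y‖ ≤ 17 / 128 * p := by
        calc (2 * (M / m) * ε + w * ε) * ‖y‖
            ≤ (2 * (M / m) * ε + (M / m / 8) * ε) * (ε / (8 * M)) := by gcongr; linarith
          _ = 17 / 64 * (ε ^ 2 / m) := by field_simp; ring
          _ ≤ 17 / 64 * (p / 2) := by
              refine mul_le_mul_of_nonneg_left ?_ (by norm_num)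
              calc ε ^ 2 / m = (2 * m) * (ε ^ 2 / m ^ 2) / 2 := by field_simp
                _ ≤ M * (ε ^ 2 / m ^ 2) / 2 := by gcongr
                _ = p / 2 := by rw [hp]; ring
          _ = _ := by ring
      have hD : M / 2 * ‖y‖ ^ 2 ≤ p / 128 := by
        calc M / 2 * ‖y‖ ^ 2 = M * ‖y‖ * ‖y‖ / 2 := by ring
          _ ≤ ε / 8 * (ε / (8 * M)) / 2 := by gcongr
          _ = ε ^ 2 / M / 128 := by field_simp; ring
          _ ≤ p / 128 := by
              gcongr
              rw [hp, div_le_iff₀ hM]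
              calc ε ^ 2 = ε ^ 2 * (m ^ 2 / m ^ 2) := by field_simp
                _ ≤ ε ^ 2 * (M ^ 2 / m ^ 2) := by gcongr; linarith
                _ = _ := by ring
      linarith

end Landscape

/-! ### Gaussian vectors -/

theorem isOpenPosMeasure_stdGaussian (n : ℕ) : (stdGaussian (E n)).IsOpenPosMeasure := by
  have : ∀ _ : Fin n, (gaussianReal 0 1).IsOpenPosMeasure := fun _ =>
    (gaussianReal_absolutelyContinuous' 0 one_ne_zero).isOpenPosMeasure
  rw [← map_pi_eq_stdGaussian]
  exact (PiLp.continuous_toLp 2 _).isOpenPosMeasure_map (WithLp.toLp_surjective 2)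

/-- Balls of a fixed radius with centre in a bounded set have Gaussian measure bounded below. -/
theorem exists_le_stdGaussian_ball (n : ℕ) {R r : ℝ} (hr : 0 < r) :
    ∃ q : ℝ, 0 < q ∧ ∀ z : E n, ‖z‖ ≤ R →
      q ≤ (stdGaussian (E n)).real (Metric.closedBall z r) := by
  have := isOpenPosMeasure_stdGaussian n
  obtain ⟨t, -, htfin, ht⟩ := (isCompact_closedBall (0 : E n) R).finite_cover_balls (half_pos hr)
  have hpos : ∀ x : E n, 0 < (stdGaussian (E n)).real (Metric.ball x (r / 2)) := fun x =>
    ENNReal.toReal_pos (Metric.measure_ball_pos _ x (half_pos hr)).ne' (measure_ne_top _ _)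
  rcases t.eq_empty_or_nonempty with rfl | hne
  · refine ⟨1, one_pos, fun z hz => ?_⟩
    have := ht (mem_closedBall_zero_iff.2 hz)
    simp at this
  · obtain ⟨x₀, -, hx₀⟩ := exists_min_image t
      (fun x => (stdGaussian (E n)).real (Metric.ball x (r / 2))) htfin hne
    refine ⟨_, hpos x₀, fun z hz => ?_⟩
    obtain ⟨x, hxt, hzx⟩ := mem_iUnion₂.1 (ht (mem_closedBall_zero_iff.2 hz))
    refine (hx₀ x hxt).trans (measureReal_mono (fun y hy => ?_))
    rw [Metric.mem_closedBall]
    rw [Metric.mem_ball] at hy hzx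
    have := dist_triangle y x z
    rw [dist_comm x z] at this
    linarith

/-- By convexity of the exponential, Fernique's theorem yields exponential moments of `1 + ‖z‖ ^ 2`
arbitrarily close to `1`. -/
theorem exists_integral_exp_le (n : ℕ) {κ : ℝ} (hκ : 0 < κ) :
    ∃ η : ℝ, 0 < η ∧
      Integrable (fun z : E n => Real.exp (η * (1 + ‖z‖ ^ 2))) (stdGaussian (E n)) ∧
      ∫ z : E n, Real.exp (η * (1 + ‖z‖ ^ 2)) ∂stdGaussian (E n) ≤ 1 + κ := by
  obtain ⟨C, hC, hint⟩ := IsGaussian.exists_integrable_exp_sq (stdGaussian (E n))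
  have hint' : Integrable (fun z : E n => Real.exp (C * (1 + ‖z‖ ^ 2))) (stdGaussian (E n)) := by
    have := hint.const_mul (Real.exp C)
    simpa only [mul_add, mul_one, Real.exp_add] using this
  set K := ∫ z : E n, Real.exp (C * (1 + ‖z‖ ^ 2)) ∂stdGaussian (E n) with hK
  have hK0 : 0 ≤ K := integral_nonneg fun z => (Real.exp_pos _).le
  set s := min 1 (κ / (K + 1)) with hs
  have hs0 : 0 < s := lt_min one_pos (by positivity)
  have hs1 : s ≤ 1 := min_le_left _ _
  have hsK : s * K ≤ κ := by
    have h1 : s ≤ κ / (K + 1) := min_le_right _ _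
    rw [le_div_iff₀ (by positivity)] at h1
    linarith
  have hle : ∀ z : E n, Real.exp (s * C * (1 + ‖z‖ ^ 2)) ≤
      (1 - s) + s * Real.exp (C * (1 + ‖z‖ ^ 2)) := fun z => by
    have := convexOn_exp.2 (mem_univ 0) (mem_univ (C * (1 + ‖z‖ ^ 2))) (sub_nonneg.2 hs1) hs0.le
      (by ring)
    simpa [mul_assoc] using this
  have hdom : Integrable (fun z : E n => (1 - s) + s * Real.exp (C * (1 + ‖z‖ ^ 2)))
      (stdGaussian (E n)) := (integrable_const _).add (hint'.const_mul s)
  have hint'' : Integrable (fun z : E n => Real.exp (s * C * (1 + ‖z‖ ^ 2)))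
      (stdGaussian (E n)) := by
    refine hdom.mono' (by fun_prop) (Filter.Eventually.of_forall fun z => ?_)
    rw [Real.norm_of_nonneg (Real.exp_pos _).le]
    exact hle z
  refine ⟨s * C, by positivity, hint'', ?_⟩
  calc _ ≤ ∫ z : E n, (1 - s) + s * Real.exp (C * (1 + ‖z‖ ^ 2)) ∂stdGaussian (E n) :=
        integral_mono hint'' hdom hle
    _ = (1 - s) + s * K := by
        rw [integral_add (integrable_const _) (hint'.const_mul s), integral_const_mul,
          integral_const, probReal_univ, one_smul]
    _ ≤ 1 + κ := by linarith

/-- Gaussian noise agrees almost surely with a sequence of scaled standard Gaussian vectors, each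
independent of its predecessors. -/
theorem IsGaussianNoise.exists_stdGaussian {n : ℕ} {Ω : Type*} [MeasurableSpace Ω] {P : Measure Ω}
    [IsProbabilityMeasure P] {σ : ℝ} (hσ : 0 < σ) {ξ : ℕ → Ω → E n} (h : IsGaussianNoise P σ ξ) :
    ∃ Z : ℕ → Ω → E n, (∀ k, Measurable (Z k)) ∧ (∀ k, P.map (Z k) = stdGaussian (E n)) ∧
      (∀ k, IndepFun (fun ω (i : Finset.range k) => Z i ω) (Z k) P) ∧
      ∀ᵐ ω ∂P, ∀ k, ξ k ω = σ • Z k ω := by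
  obtain ⟨hind, hlaw⟩ := h
  set W : ℕ × Fin n → Ω → ℝ := fun q => (hlaw q.1 q.2).aemeasurable.mk _ with hW
  have hWm : ∀ q, Measurable (W q) := fun q => (hlaw q.1 q.2).aemeasurable.measurable_mk
  have hWae : ∀ q : ℕ × Fin n, (fun ω => ξ q.1 ω q.2) =ᵐ[P] W q := fun q =>
    (hlaw q.1 q.2).aemeasurable.ae_eq_mk
  have hWind : iIndepFun W P := hind.congr hWae
  have hWlaw : ∀ q, P.map (W q) = gaussianReal 0 (Real.toNNReal (σ ^ 2)) := fun q => by
    rw [← Measure.map_congr (hWae q)]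
    exact (hlaw q.1 q.2).map_eq
  have hYm : ∀ q, Measurable fun ω => σ⁻¹ * W q ω := fun q => (hWm q).const_mul _
  have hYind : iIndepFun (fun q ω => σ⁻¹ * W q ω) P :=
    hWind.comp (fun _ t => σ⁻¹ * t) fun _ => measurable_const_mul _
  have hYlaw : ∀ q, P.map (fun ω => σ⁻¹ * W q ω) = gaussianReal 0 1 := fun q => by
    have h1 := (gaussianReal_const_mul (X := W q) (P := P) ⟨(hWm q).aemeasurable, hWlaw q⟩
      σ⁻¹).map_eq
    rw [h1, mul_zero]
    congr 1
    ext
    rw [NNReal.coe_mul, Real.coe_toNNReal _ (sq_nonneg σ)]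
    change σ⁻¹ ^ 2 * σ ^ 2 = 1
    field_simp
  refine ⟨fun k ω => WithLp.toLp 2 fun i => σ⁻¹ * W (k, i) ω, fun k => ?_, fun k => ?_,
    fun k => ?_, ?_⟩
  · exact (PiLp.continuous_toLp 2 _).measurable.comp (measurable_pi_lambda _ fun i => hYm (k, i))
  · have h1 : iIndepFun (fun (i : Fin n) ω => σ⁻¹ * W (k, i) ω) P :=
      hYind.precomp (g := fun i : Fin n => (k, i)) (Prod.mk_right_injective k)
    rw [← map_pi_eq_stdGaussian]
    have h2 := (iIndepFun_iff_map_fun_eq_pi_map fun i => (hYm (k, i)).aemeasurable).1 h1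
    simp_rw [hYlaw] at h2
    rw [← h2, Measure.map_map (PiLp.continuous_toLp 2 _).measurable
      (measurable_pi_lambda _ fun i => hYm (k, i))]
    rfl
  · have hdisj : Disjoint (Finset.range k ×ˢ (Finset.univ : Finset (Fin n)))
        ({k} ×ˢ (Finset.univ : Finset (Fin n))) := by
      rw [Finset.disjoint_left]
      rintro ⟨a, b⟩ h1 h2
      simp only [Finset.mem_product, Finset.mem_range, Finset.mem_singleton] at h1 h2
      omega
    have h1 := hYind.indepFun_finset _ _ hdisj hYm
    refine h1.comp
      (φ := fun u (i : Finset.range k) => (WithLp.toLp 2 fun j : Fin n =>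
        u ⟨(i.1, j), Finset.mem_product.2 ⟨i.2, Finset.mem_univ j⟩⟩ : E n))
      (ψ := fun u => (WithLp.toLp 2 fun j : Fin n =>
        u ⟨(k, j), Finset.mem_product.2 ⟨Finset.mem_singleton_self k, Finset.mem_univ j⟩⟩ : E n))
      ?_ ?_
    · exact measurable_pi_lambda _ fun i => (PiLp.continuous_toLp 2 _).measurable.comp
        (measurable_pi_lambda _ fun j => measurable_pi_apply _)
    · exact (PiLp.continuous_toLp 2 _).measurable.comp
        (measurable_pi_lambda _ fun j => measurable_pi_apply _)
  · filter_upwards [ae_all_iff.2 hWae] with ω hω k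
    ext i
    have := hω (k, i)
    simp only at this
    simp only [PiLp.smul_apply, smul_eq_mul, this]
    field_simp

/-! ### Survival probabilities of a randomly driven iteration -/

section Survival

variable {S F : Type*} [MeasurableSpace F]

open Classical in
/-- The probability that the chain driven by independent inputs with law `ν`, started at `s`, is in
`A` after `k` steps. -/
noncomputable def survival (ν : Measure F) (step : F → S → S) (A : Set S) : ℕ → S → ENNReal
  | 0, s => if s ∈ A then 1 else 0
  | k + 1, s => ∫⁻ z, survival ν step A k (step z s) ∂ν

variable {ν : Measure F} {step : F → S → S} {A : Set S}

/-- A geometric drift condition bounds the survival probability; no measurability of the drift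
function is needed. -/
theorem survival_le_pow_mul {V : S → ENNReal} {ρ : ENNReal} (hV : ∀ s ∈ A, 1 ≤ V s)
    (hdrift : ∀ s, ∫⁻ z, V (step z s) ∂ν ≤ ρ * V s) (hρ : ρ ≠ ⊤) (k : ℕ) (s : S) :
    survival ν step A k s ≤ ρ ^ k * V s := by
  induction k generalizing s with
  | zero =>
    rw [survival, pow_zero, one_mul]
    split_ifs with h
    · exact hV s h
    · exact zero_le
  | succ k ih =>
    calc survival ν step A (k + 1) s ≤ ∫⁻ z, ρ ^ k * V (step z s) ∂ν := lintegral_mono fun z => ih _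
      _ = ρ ^ k * ∫⁻ z, V (step z s) ∂ν := lintegral_const_mul' _ _ (ENNReal.pow_ne_top hρ)
      _ ≤ ρ ^ k * (ρ * V s) := by gcongr; exact hdrift s
      _ = _ := by rw [pow_succ, mul_assoc]

variable [MeasurableSpace S]

theorem measurable_survival [SFinite ν] (hstep : Measurable fun q : F × S => step q.1 q.2)
    (hA : MeasurableSet A) (k : ℕ) : Measurable (survival ν step A k) := by
  induction k with
  | zero =>
    exact Measurable.ite hA measurable_const measurable_const
  | succ k ih =>
    exact Measurable.lintegral_prod_left' (f := fun q : F × S => survival ν step A k (step q.1 q.2))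
      (ih.comp hstep)

theorem exists_factor_of_recursion {Ω : Type*} {Z : ℕ → Ω → F} {X : ℕ → Ω → S} {s₀ : S}
    (hstep : Measurable fun q : F × S => step q.1 q.2) (hX0 : ∀ ω, X 0 ω = s₀)
    (hX : ∀ k ω, X (k + 1) ω = step (Z k ω) (X k ω)) (k : ℕ) :
    ∃ G : (Finset.range k → F) → S, Measurable G ∧ ∀ ω, X k ω = G fun i => Z i ω := by
  induction k with
  | zero => exact ⟨fun _ => s₀, measurable_const, hX0⟩
  | succ k ih =>
    obtain ⟨G, hG, hXG⟩ := ih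
    refine ⟨fun u => step (u ⟨k, Finset.self_mem_range_succ k⟩)
      (G fun i => u ⟨i, Finset.mem_range.2 ((Finset.mem_range.1 i.2).trans (Nat.lt_succ_self k))⟩),
      ?_, fun ω => ?_⟩
    · have h1 : Measurable fun u : Finset.range (k + 1) → F =>
          u ⟨k, Finset.self_mem_range_succ k⟩ := measurable_pi_apply _
      have h2 : Measurable fun (u : Finset.range (k + 1) → F) (i : Finset.range k) => u ⟨i,
          Finset.mem_range.2 ((Finset.mem_range.1 i.2).trans (Nat.lt_succ_self k))⟩ :=
        measurable_pi_lambda _ fun i => measurable_pi_apply _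
      exact hstep.comp (h1.prodMk (hG.comp h2))
    · rw [hX, hXG]

theorem measure_mem_eq_survival {Ω : Type*} [MeasurableSpace Ω] {P : Measure Ω}
    [IsProbabilityMeasure P] [IsProbabilityMeasure ν] {Z : ℕ → Ω → F} {X : ℕ → Ω → S} {s₀ : S}
    (hstep : Measurable fun q : F × S => step q.1 q.2) (hA : MeasurableSet A)
    (hZ : ∀ k, Measurable (Z k)) (hlaw : ∀ k, P.map (Z k) = ν)
    (hind : ∀ k, IndepFun (fun ω (i : Finset.range k) => Z i ω) (Z k) P)
    (hX0 : ∀ ω, X 0 ω = s₀) (hX : ∀ k ω, X (k + 1) ω = step (Z k ω) (X k ω)) (k : ℕ) :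
    P {ω | X k ω ∈ A} = survival ν step A k s₀ := by
  have hXm : ∀ k, Measurable (X k) := fun k => by
    obtain ⟨G, hG, hXG⟩ := exists_factor_of_recursion hstep hX0 hX k
    rw [funext hXG]
    exact hG.comp (measurable_pi_lambda _ fun i => hZ i)
  have hXind : ∀ k, IndepFun (X k) (Z k) P := fun k => by
    obtain ⟨G, hG, hXG⟩ := exists_factor_of_recursion hstep hX0 hX k
    rw [funext hXG]
    exact (hind k).comp hG measurable_id
  have key : ∀ j i, ∫⁻ ω, survival ν step A i (X j ω) ∂P = survival ν step A (i + j) s₀ := by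
    intro j
    induction j with
    | zero =>
      intro i
      simp [hX0]
    | succ j ih =>
      intro i
      have hm := measurable_survival (ν := ν) hstep hA i
      have hm2 : Measurable fun q : S × F => survival ν step A i (step q.2 q.1) :=
        (hm.comp hstep).comp measurable_swap
      have h1 : P.map (fun ω => (X j ω, Z j ω)) = (P.map (X j)).prod ν := by
        rw [(hXind j).map_prod_eq_prod_map_map (hXm j).aemeasurable (hZ j).aemeasurable, hlaw]
      calc ∫⁻ ω, survival ν step A i (X (j + 1) ω) ∂P
          = ∫⁻ ω, survival ν step A i (step (Z j ω) (X j ω)) ∂P := by simp_rw [hX]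
        _ = ∫⁻ q, survival ν step A i (step q.2 q.1) ∂(P.map fun ω => (X j ω, Z j ω)) :=
            (lintegral_map hm2 ((hXm j).prodMk (hZ j))).symm
        _ = ∫⁻ s, ∫⁻ z, survival ν step A i (step z s) ∂ν ∂(P.map (X j)) := by
            rw [h1, lintegral_prod _ hm2.aemeasurable]
        _ = ∫⁻ ω, survival ν step A (i + 1) (X j ω) ∂P :=
            lintegral_map (measurable_survival hstep hA (i + 1)) (hXm j)
        _ = survival ν step A (i + (j + 1)) s₀ := by rw [ih]; congr 1; ring
  have h := key k 0
  rw [zero_add] at h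
  have hset : MeasurableSet {ω | X k ω ∈ A} := hXm k hA
  rw [← h, ← lintegral_indicator_one hset]
  refine lintegral_congr fun ω => ?_
  by_cases hω : X k ω ∈ A <;> simp [survival, hω]

end Survival

/-! ### The drift of the potential -/

/-- The potential of a state: the Newton steps pending in a burst are charged `τ` each. -/
noncomputable def statePotential {n : ℕ} (M L m d a ε θ τ : ℝ) (f : E n → ℝ) (s : State n) : ℝ :=
  pointPotential M L m d a ε θ f s.1 + τ * s.2

open Classical in
/-- The drift function: the exponential of the potential, normalized by a lower bound `Φ₀`, and
zero once the method has stopped. -/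
noncomputable def driftFunction {n : ℕ} (M L m d a ε θ τ Φ₀ : ℝ) (f : E n → ℝ) (s : State n) :
    ENNReal :=
  if Stopped ε f s then 0
  else ENNReal.ofReal (Real.exp (statePotential M L m d a ε θ τ f s - Φ₀))

section Drift

variable {n : ℕ} {f : E n → ℝ} {M L m α β γ ζ κ d a ε θ τ Φ₀ η q ρ : ℝ} {s : State n}

theorem iterStep_of_pos (ξ : E n) (h : 0 < s.2) :
    iterStep M m α β γ ζ ε f ξ s = (newtonStep m α β f s.1, s.2 - 1) := by
  rw [iterStep, if_pos h]

theorem iterStep_of_lt (ξ : E n) (h0 : s.2 = 0) (h : ε < ‖∇ f s.1‖) :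
    iterStep M m α β γ ζ ε f ξ s = (newtonStep m α β f s.1, 0) := by
  rw [iterStep, if_neg (by omega), if_pos h]

theorem iterStep_of_hasNegativeCurvature (ξ : E n) (h0 : s.2 = 0) (h : ‖∇ f s.1‖ ≤ ε)
    (hneg : HasNegativeCurvature f s.1) :
    (‖∇ f (s.1 + ξ)‖ ≤ (2 * Real.sqrt n * (M / m) + 1) * ε ∧
      iterStep M m α β γ ζ ε f ξ s = (s.1 + ξ, burst γ ζ)) ∨
    (¬ ‖∇ f (s.1 + ξ)‖ ≤ (2 * Real.sqrt n * (M / m) + 1) * ε ∧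
      iterStep M m α β γ ζ ε f ξ s = s) := by
  by_cases h1 : ‖∇ f (s.1 + ξ)‖ ≤ (2 * Real.sqrt n * (M / m) + 1) * ε
  · left
    rw [iterStep, if_neg (by omega), if_neg (not_lt.2 h), if_pos hneg, if_pos h1]
    exact ⟨h1, rfl⟩
  · right
    rw [iterStep, if_neg (by omega), if_neg (not_lt.2 h), if_pos hneg, if_neg h1]
    exact ⟨h1, rfl⟩

theorem iterStep_of_stopped (ξ : E n) (h : Stopped ε f s) :
    iterStep M m α β γ ζ ε f ξ s = s := by
  rw [iterStep, if_neg (by have := h.1; omega), if_neg (not_lt.2 h.2.1), if_neg h.2.2]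

theorem driftFunction_le (s : State n) : driftFunction M L m d a ε θ τ Φ₀ f s ≤
    ENNReal.ofReal (Real.exp (statePotential M L m d a ε θ τ f s - Φ₀)) := by
  unfold driftFunction
  split_ifs
  · exact zero_le
  · exact le_rfl

/-- The effect on the potential of one draw near a saddle, in terms of the standardized noise
vector `z`. A ball of vectors `z`, with radius and distance to the origin bounded independently of
`ε`, decreases the potential by one. -/
theorem Landscape.exists_exp_statePotential_le (h : Landscape M L m α β κ d f) (hε : 0 < ε)
    (ha0 : 0 ≤ a) (ha1 : a ≤ 1) (hθ0 : 0 ≤ θ) (hτ0 : 0 ≤ τ)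
    (hεd : (2 * Real.sqrt n * (M / m) + 1) * ε ≤ d)
    (hε1 : 8 * (L * M ^ 2 / m ^ 4 * ε) ≤ 1) (hε2 : 8 * (L * M ^ 2 / m ^ 4 * ε) ≤ M / m)
    (hε3 : (1 / m + M / m ^ 2 + 1 / (8 * M)) * ε < m / L)
    (hη : τ * burst γ ζ + (θ * ε ^ 2 + a) * (2 / m + 2 * M / m ^ 2) +
      8 * localBound M m d ε * L ^ 2 * ε ^ 2 / m ^ 4 ≤ η)
    (h0 : s.2 = 0) (hs : ‖∇ f s.1‖ ≤ ε) (hneg : HasNegativeCurvature f s.1) :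
    ∃ z₀ : E n, ‖z₀‖ ≤ 1 / 2 + M / (2 * m) ∧ ∀ z : E n,
      Real.exp (statePotential M L m d a ε θ τ f
        (iterStep M m α β γ ζ ε f ((2 * ε / m) • z) s)) ≤
      Real.exp (statePotential M L m d a ε θ τ f s) * (Real.exp (η * (1 + ‖z‖ ^ 2)) -
        (1 / 2) * (Metric.closedBall z₀ (m / (16 * M))).indicator 1 z) := by
  have hM := h.M_pos
  have hm := h.m_pos
  have hL := h.L_pos
  have hσ : 0 < 2 * ε / m := by positivity
  have hsqrt : (1 : ℝ) ≤ Real.sqrt n := by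
    rw [Real.one_le_sqrt, Nat.one_le_cast, Nat.one_le_iff_ne_zero]
    rintro rfl
    obtain ⟨v, hv⟩ := hneg
    rw [Subsingleton.elim v 0, inner_zero_right] at hv
    exact lt_irrefl _ hv
  have hC : (2 * (M / m) + 1) * ε ≤ (2 * Real.sqrt n * (M / m) + 1) * ε := by
    have : 2 * (M / m) ≤ 2 * Real.sqrt n * (M / m) := by
      have : 2 * 1 * (M / m) ≤ 2 * Real.sqrt n * (M / m) := by gcongr
      linarith
    gcongr
  have hεled : ε ≤ d := by
    have : 0 ≤ 2 * Real.sqrt n * (M / m) * ε := by positivity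
    linarith
  obtain ⟨c, hc, hxc⟩ := h.exists_critical s.1 (hs.trans hεled)
  obtain ⟨X₀, hX₀, hball⟩ := h.exists_good_ball hε hε1 hε2 hc hxc hs hneg
  have hΛ : 0 ≤ localBound M m d ε := zero_le_one.trans (one_le_localBound hM.le)
  have hB : 0 ≤ τ * (burst γ ζ : ℝ) := by positivity
  have hη0 : 0 ≤ η := le_trans (by positivity) hη
  refine ⟨(m / (2 * ε)) • X₀, ?_, fun z => ?_⟩
  · rw [norm_smul, Real.norm_of_nonneg (by positivity)]
    calc m / (2 * ε) * ‖X₀‖ ≤ m / (2 * ε) * ((1 / m + M / m ^ 2) * ε) := by gcongr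
      _ = _ := by field_simp
  set X := (2 * ε / m) • z with hX
  have hXn : ‖X‖ = 2 * ε / m * ‖z‖ := by rw [hX, norm_smul, Real.norm_of_nonneg hσ.le]
  have hmem : z ∈ Metric.closedBall ((m / (2 * ε)) • X₀) (m / (16 * M)) →
      ‖X - X₀‖ ≤ ε / (8 * M) := fun hz => by
    rw [Metric.mem_closedBall, dist_eq_norm] at hz
    have h1 : X - X₀ = (2 * ε / m) • (z - (m / (2 * ε)) • X₀) := by
      rw [smul_sub, smul_smul, hX]
      congr 1
      rw [show 2 * ε / m * (m / (2 * ε)) = 1 by field_simp, one_smul]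
    rw [h1, norm_smul, Real.norm_of_nonneg hσ.le]
    calc 2 * ε / m * ‖z - (m / (2 * ε)) • X₀‖ ≤ 2 * ε / m * (m / (16 * M)) := by gcongr
      _ = ε / (8 * M) := by field_simp; norm_num
  have hexp1 : 1 ≤ Real.exp (η * (1 + ‖z‖ ^ 2)) := Real.one_le_exp (by positivity)
  have hz1 : ‖z‖ ≤ 1 + ‖z‖ ^ 2 := by nlinarith [sq_nonneg (‖z‖ - 1), sq_nonneg ‖z‖]
  have hz2 : ‖z‖ ^ 2 ≤ 1 + ‖z‖ ^ 2 := by linarith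
  have hcost : τ * burst γ ζ + (θ + a / ε ^ 2) * (ε * ‖X‖ + M / 2 * ‖X‖ ^ 2) +
      2 * localBound M m d ε * (L / m) ^ 2 * ‖X‖ ^ 2 ≤ η * (1 + ‖z‖ ^ 2) := by
    have h1 : (θ + a / ε ^ 2) * (ε * ‖X‖ + M / 2 * ‖X‖ ^ 2) =
        (θ * ε ^ 2 + a) * (2 / m * ‖z‖ + 2 * M / m ^ 2 * ‖z‖ ^ 2) := by
      rw [hXn]; field_simp
    have h2 : 2 * localBound M m d ε * (L / m) ^ 2 * ‖X‖ ^ 2 =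
        8 * localBound M m d ε * L ^ 2 * ε ^ 2 / m ^ 4 * ‖z‖ ^ 2 := by
      rw [hXn]; field_simp; ring
    have h3 : 2 / m * ‖z‖ + 2 * M / m ^ 2 * ‖z‖ ^ 2 ≤
        (2 / m + 2 * M / m ^ 2) * (1 + ‖z‖ ^ 2) := by
      rw [add_mul]
      gcongr
    calc _ ≤ τ * burst γ ζ * (1 + ‖z‖ ^ 2) +
          (θ * ε ^ 2 + a) * ((2 / m + 2 * M / m ^ 2) * (1 + ‖z‖ ^ 2)) +
          8 * localBound M m d ε * L ^ 2 * ε ^ 2 / m ^ 4 * (1 + ‖z‖ ^ 2) := by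
          rw [h1, h2]
          have h4 : τ * burst γ ζ ≤ τ * burst γ ζ * (1 + ‖z‖ ^ 2) :=
            le_mul_of_one_le_right hB (by linarith [sq_nonneg ‖z‖])
          have h5 : (θ * ε ^ 2 + a) * (2 / m * ‖z‖ + 2 * M / m ^ 2 * ‖z‖ ^ 2) ≤
              (θ * ε ^ 2 + a) * ((2 / m + 2 * M / m ^ 2) * (1 + ‖z‖ ^ 2)) := by gcongr
          have h6 : 8 * localBound M m d ε * L ^ 2 * ε ^ 2 / m ^ 4 * ‖z‖ ^ 2 ≤
              8 * localBound M m d ε * L ^ 2 * ε ^ 2 / m ^ 4 * (1 + ‖z‖ ^ 2) := by gcongr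
          exact add_le_add (add_le_add h4 h5) h6
      _ = (τ * burst γ ζ + (θ * ε ^ 2 + a) * (2 / m + 2 * M / m ^ 2) +
          8 * localBound M m d ε * L ^ 2 * ε ^ 2 / m ^ 4) * (1 + ‖z‖ ^ 2) := by ring
      _ ≤ _ := by gcongr
  rcases iterStep_of_hasNegativeCurvature (M := M) (m := m) (α := α) (β := β) (γ := γ) (ζ := ζ)
    X h0 hs hneg with ⟨hacc, hit⟩ | ⟨hrej, hit⟩
  · obtain ⟨hA, hG⟩ := h.pointPotential_add_le hε hεled ha0 ha1 hθ0 hc hxc hs (hacc.trans hεd)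
    rw [hit]
    have hst : statePotential M L m d a ε θ τ f s = pointPotential M L m d a ε θ f s.1 := by
      rw [statePotential, h0]; simp
    by_cases hz : z ∈ Metric.closedBall ((m / (2 * ε)) • X₀) (m / (16 * M))
    · have hXball := hmem hz
      have hXlt : ‖X‖ < m / L := by
        calc ‖X‖ = ‖X₀ + (X - X₀)‖ := by congr 1; abel
          _ ≤ (1 / m + M / m ^ 2) * ε + ε / (8 * M) := (norm_add_le _ _).trans (by gcongr)
          _ = (1 / m + M / m ^ 2 + 1 / (8 * M)) * ε := by ring
          _ < m / L := hε3
      have hdrop := hG hXlt (hball X hXball).2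
      have h2 : 0 ≤ 2 * localBound M m d ε * (L / m) ^ 2 * ‖X‖ ^ 2 := by positivity
      have h3 : statePotential M L m d a ε θ τ f (s.1 + X, burst γ ζ) ≤
          statePotential M L m d a ε θ τ f s + (η * (1 + ‖z‖ ^ 2) - 1) := by
        rw [hst, statePotential]
        simp only
        linarith
      refine (Real.exp_le_exp.2 h3).trans ?_
      rw [Real.exp_add, indicator_of_mem hz, Pi.one_apply, mul_one]
      refine mul_le_mul_of_nonneg_left ?_ (Real.exp_pos _).le
      rw [sub_eq_add_neg (η * _), Real.exp_add]
      have h4 : Real.exp (-1) ≤ 1 / 2 := by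
        rw [Real.exp_neg, one_div]
        exact inv_anti₀ two_pos (by linarith [Real.add_one_le_exp 1])
      have h5 := mul_le_mul_of_nonneg_left h4 (zero_le_one.trans hexp1)
      linarith
    · have h3 : statePotential M L m d a ε θ τ f (s.1 + X, burst γ ζ) ≤
          statePotential M L m d a ε θ τ f s + η * (1 + ‖z‖ ^ 2) := by
        rw [hst, statePotential]
        simp only
        linarith
      rw [indicator_of_notMem hz, mul_zero, sub_zero, ← Real.exp_add]
      exact Real.exp_le_exp.2 h3
  · have hz : z ∉ Metric.closedBall ((m / (2 * ε)) • X₀) (m / (16 * M)) := fun hz =>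
      hrej ((hball X (hmem hz)).1.trans hC)
    rw [hit, indicator_of_notMem hz, mul_zero, sub_zero]
    exact le_mul_of_one_le_right (Real.exp_pos _).le hexp1

theorem lintegral_driftFunction_le_of_forall {ν : Measure (E n)} [IsProbabilityMeasure ν]
    (hs : ¬ Stopped ε f s) {step : E n → State n} (hρ : 0 ≤ ρ) {t : ℝ} (ht : Real.exp (-t) ≤ ρ)
    (h : ∀ z, statePotential M L m d a ε θ τ f (step z) ≤
      statePotential M L m d a ε θ τ f s - t) :
    ∫⁻ z, driftFunction M L m d a ε θ τ Φ₀ f (step z) ∂ν ≤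
      ENNReal.ofReal ρ * driftFunction M L m d a ε θ τ Φ₀ f s := by
  have hR : driftFunction M L m d a ε θ τ Φ₀ f s =
    ENNReal.ofReal (Real.exp (statePotential M L m d a ε θ τ f s - Φ₀)) := if_neg hs
  rw [hR, ← ENNReal.ofReal_mul hρ]
  refine (lintegral_mono (g := fun _ => _) fun z => (driftFunction_le (step z)).trans
    (ENNReal.ofReal_le_ofReal ?_)).trans_eq (by rw [lintegral_const, measure_univ, mul_one])
  calc Real.exp (statePotential M L m d a ε θ τ f (step z) - Φ₀)
      ≤ Real.exp (-t + (statePotential M L m d a ε θ τ f s - Φ₀)) :=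
        Real.exp_le_exp.2 (by linarith [h z])
    _ ≤ ρ * Real.exp (statePotential M L m d a ε θ τ f s - Φ₀) := by
        rw [Real.exp_add]; gcongr

/-- The drift function decreases in the mean by a fixed factor in every iteration. -/
theorem Landscape.lintegral_driftFunction_le (h : Landscape M L m α β κ d f) (hε : 0 < ε)
    (ha0 : 0 ≤ a) (ha1 : a ≤ 1) (hτ0 : 0 ≤ τ)
    (hθ : 3 * localBound M m d ε ≤ θ * (decreaseConst M m α β * (d / (1 + M / m)) ^ 2))
    (hεd : (2 * Real.sqrt n * (M / m) + 1) * ε ≤ d)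
    (hε1 : 8 * (L * M ^ 2 / m ^ 4 * ε) ≤ 1) (hε2 : 8 * (L * M ^ 2 / m ^ 4 * ε) ≤ M / m)
    (hε3 : (1 / m + M / m ^ 2 + 1 / (8 * M)) * ε < m / L)
    (hη : τ * burst γ ζ + (θ * ε ^ 2 + a) * (2 / m + 2 * M / m ^ 2) +
      8 * localBound M m d ε * L ^ 2 * ε ^ 2 / m ^ 4 ≤ η)
    (hq : ∀ z : E n, ‖z‖ ≤ 1 / 2 + M / (2 * m) →
      q ≤ (stdGaussian (E n)).real (Metric.closedBall z (m / (16 * M))))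
    (hint : Integrable (fun z : E n => Real.exp (η * (1 + ‖z‖ ^ 2))) (stdGaussian (E n)))
    (hint_le : ∫ z : E n, Real.exp (η * (1 + ‖z‖ ^ 2)) ∂stdGaussian (E n) ≤ 1 + q / 4)
    (hρ : 0 ≤ ρ) (hρτ : Real.exp (-τ) ≤ ρ)
    (hρa : Real.exp (-min 1 (a * gapRate M m α β / 2)) ≤ ρ) (hρq : 1 - q / 4 ≤ ρ)
    (s : State n) :
    ∫⁻ z, driftFunction M L m d a ε θ τ Φ₀ f (iterStep M m α β γ ζ ε f ((2 * ε / m) • z) s)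
        ∂stdGaussian (E n) ≤
      ENNReal.ofReal ρ * driftFunction M L m d a ε θ τ Φ₀ f s := by
  have hM := h.M_pos
  have hm := h.m_pos
  have hL := h.L_pos
  have hd := h.d_pos
  have hθ0 : 0 ≤ θ := by
    have h1 := decreaseConst_pos hM hm h.α_mem.1 h.β_mem.1
    have h2 : 0 < decreaseConst M m α β * (d / (1 + M / m)) ^ 2 := by positivity
    have h3 := one_le_localBound (M := M) (m := m) (d := d) (ε := ε) hM.le
    exact (pos_of_mul_pos_left (by linarith) h2.le).le
  by_cases hs : Stopped ε f s
  · have h1 : driftFunction M L m d a ε θ τ Φ₀ f s = 0 := if_pos hs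
    simp_rw [iterStep_of_stopped _ hs, h1]
    simp
  rcases Nat.eq_zero_or_pos s.2 with h0 | hpos
  · rcases lt_or_ge ε ‖∇ f s.1‖ with hlt | hge
    · refine lintegral_driftFunction_le_of_forall hs hρ hρa fun z => ?_
      rw [iterStep_of_lt _ h0 hlt, statePotential, statePotential, h0]
      have := (h.pointPotential_newtonStep_le hε ha0 ha1 hθ0 hθ s.1).2 hlt
      linarith
    · have hneg : HasNegativeCurvature f s.1 := by
        by_contra hn
        exact hs ⟨h0, hge, hn⟩
      obtain ⟨z₀, hz₀, hz⟩ := h.exists_exp_statePotential_le hε ha0 ha1 hθ0 hτ0 hεd hε1 hε2 hε3 hη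
        h0 hge hneg
      have hR : driftFunction M L m d a ε θ τ Φ₀ f s =
        ENNReal.ofReal (Real.exp (statePotential M L m d a ε θ τ f s - Φ₀)) := if_neg hs
      set W := Real.exp (statePotential M L m d a ε θ τ f s - Φ₀) with hW
      set B := Metric.closedBall z₀ (m / (16 * M)) with hB
      have hBm : MeasurableSet B := Metric.isClosed_closedBall.measurableSet
      have hind : Integrable (B.indicator (1 : E n → ℝ)) (stdGaussian (E n)) :=
        (integrable_const (1 : ℝ)).indicator hBm
      have hle : ∀ z, Real.exp (statePotential M L m d a ε θ τ f
          (iterStep M m α β γ ζ ε f ((2 * ε / m) • z) s) - Φ₀) ≤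
          W * (Real.exp (η * (1 + ‖z‖ ^ 2)) - 1 / 2 * B.indicator 1 z) := fun z => by
        rw [hW, sub_eq_add_neg, sub_eq_add_neg (statePotential M L m d a ε θ τ f s), Real.exp_add,
          Real.exp_add, mul_right_comm]
        exact mul_le_mul_of_nonneg_right (hz z) (Real.exp_pos _).le
      have hint2 : Integrable (fun z => W * (Real.exp (η * (1 + ‖z‖ ^ 2)) -
          1 / 2 * B.indicator 1 z)) (stdGaussian (E n)) :=
        (hint.sub (hind.const_mul _)).const_mul W
      have hnonneg : ∀ z, 0 ≤ W * (Real.exp (η * (1 + ‖z‖ ^ 2)) - 1 / 2 * B.indicator 1 z) :=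
        fun z => (Real.exp_pos _).le.trans (hle z)
      rw [hR, ← ENNReal.ofReal_mul hρ]
      calc _ ≤ ∫⁻ z, ENNReal.ofReal (W * (Real.exp (η * (1 + ‖z‖ ^ 2)) -
            1 / 2 * B.indicator 1 z)) ∂stdGaussian (E n) :=
            lintegral_mono fun z => (driftFunction_le _).trans (ENNReal.ofReal_le_ofReal (hle z))
        _ = ENNReal.ofReal (∫ z, W * (Real.exp (η * (1 + ‖z‖ ^ 2)) -
            1 / 2 * B.indicator 1 z) ∂stdGaussian (E n)) :=
            (ofReal_integral_eq_lintegral_ofReal hint2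
              (Filter.Eventually.of_forall hnonneg)).symm
        _ ≤ ENNReal.ofReal (ρ * W) := by
            refine ENNReal.ofReal_le_ofReal ?_
            rw [integral_const_mul, integral_sub hint (hind.const_mul _), integral_const_mul,
              integral_indicator_one hBm, mul_comm]
            have hW0 : 0 ≤ W := (Real.exp_pos _).le
            refine mul_le_mul_of_nonneg_right ?_ hW0
            have := hq z₀ hz₀
            linarith
  · refine lintegral_driftFunction_le_of_forall hs hρ hρτ fun z => ?_
    rw [iterStep_of_pos _ hpos, statePotential, statePotential]
    have h1 := (h.pointPotential_newtonStep_le hε ha0 ha1 hθ0 hθ s.1).1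
    have h2 : ((s.2 - 1 : ℕ) : ℝ) = s.2 - 1 := by
      rw [Nat.cast_sub hpos, Nat.cast_one]
    simp only [h2]
    linarith

end Drift

/-! ### The iteration bound -/

theorem arsinh_le_log {y : ℝ} (hy : 0 ≤ y) : Real.arsinh y ≤ Real.log (1 + 2 * y) := by
  have h1 : Real.sqrt (1 + y ^ 2) ≤ 1 + y := (Real.sqrt_le_left (by positivity)).2 (by nlinarith)
  have h2 : 0 < Real.sqrt (1 + y ^ 2) := Real.sqrt_pos.2 (by positivity)
  exact Real.log_le_log (by positivity) (by linarith)

theorem localBound_le_log {M m d ε : ℝ} (hM : 0 ≤ M) (hε : 0 < ε) (hε1 : ε ≤ 1) :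
    localBound M m d ε ≤
      (Real.log (1 + 2 * (M / (2 * m ^ 2) * d ^ 2)) + 2) * (1 + Real.log (1 / ε)) := by
  set K := M / (2 * m ^ 2) * d ^ 2 with hK
  have hK0 : 0 ≤ K := by positivity
  have h1 : Real.arsinh (K / ε ^ 2) ≤ Real.log (1 + 2 * K) + 2 * Real.log (1 / ε) := by
    refine (arsinh_le_log (by positivity)).trans ?_
    have h2 : 1 + 2 * (K / ε ^ 2) ≤ (1 + 2 * K) * (1 / ε) ^ 2 := by
      have h3 : 1 ≤ (1 / ε) ^ 2 := one_le_pow₀ (by rw [le_div_iff₀ hε]; linarith)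
      have h4 : 2 * (K / ε ^ 2) = 2 * K * (1 / ε) ^ 2 := by field_simp
      rw [h4]
      linarith
    refine (Real.log_le_log (by positivity) h2).trans_eq ?_
    rw [Real.log_mul (by positivity) (by positivity), Real.log_pow]
    norm_num
  have h5 : 0 ≤ Real.log (1 / ε) := Real.log_nonneg (by rw [le_div_iff₀ hε]; linarith)
  have h6 : 0 ≤ Real.log (1 + 2 * K) := Real.log_nonneg (by linarith)
  unfold localBound
  nlinarith [mul_nonneg h6 h5]

theorem localBound_mul_sq_le {M m d ε : ℝ} (hM : 0 ≤ M) (hε : 0 < ε) (hε1 : ε ≤ 1) :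
    localBound M m d ε * ε ^ 2 ≤ (Real.log (1 + 2 * (M / (2 * m ^ 2) * d ^ 2)) + 2) * ε := by
  have h1 := localBound_le_log (m := m) (d := d) hM hε hε1
  have h2 : 1 + Real.log (1 / ε) ≤ 1 / ε := by
    linarith [Real.log_le_sub_one_of_pos (show 0 < 1 / ε by positivity)]
  have hK : 0 ≤ Real.log (1 + 2 * (M / (2 * m ^ 2) * d ^ 2)) :=
    Real.log_nonneg (by linarith [show 0 ≤ M / (2 * m ^ 2) * d ^ 2 by positivity])
  calc localBound M m d ε * ε ^ 2
      ≤ (Real.log (1 + 2 * (M / (2 * m ^ 2) * d ^ 2)) + 2) * (1 / ε) * ε ^ 2 := by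
        refine mul_le_mul_of_nonneg_right (h1.trans ?_) (sq_nonneg ε)
        gcongr
    _ = _ := by field_simp

/-- A geometric drift yields an exponential tail for the number of iterations. -/
theorem Landscape.measure_not_stopped_le {n : ℕ} {f : E n → ℝ} {M L m α β κ d ρ ε γ ζ : ℝ}
    (h : Landscape M L m α β κ d f) (hε : 0 < ε) {V : State n → ENNReal}
    (hV : ∀ s, ¬ Stopped ε f s → 1 ≤ V s)
    (hdrift : ∀ s, ∫⁻ z, V (iterStep M m α β γ ζ ε f ((2 * ε / m) • z) s) ∂stdGaussian (E n) ≤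
      ENNReal.ofReal ρ * V s)
    (x₀ : E n) {Ω : Type*} [MeasurableSpace Ω] (P : Measure Ω) [IsProbabilityMeasure P]
    {ξ : ℕ → Ω → E n} (hξ : IsGaussianNoise P (2 * ε / m) ξ) (k : ℕ) :
    P {ω | ¬ Stopped ε f (run M m α β γ ζ ε f x₀ (fun j => ξ j ω) k)} ≤
      ENNReal.ofReal ρ ^ k * V (x₀, 0) := by
  have hσ : 0 < 2 * ε / m := div_pos (by positivity) h.m_pos
  obtain ⟨Z, hZm, hZlaw, hZind, hZae⟩ := hξ.exists_stdGaussian hσ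
  set step : E n → State n → State n := fun z s =>
    iterStep M m α β γ ζ ε f ((2 * ε / m) • z) s with hstepdef
  have hstep : Measurable fun q : E n × State n => step q.1 q.2 := by
    have h1 : Measurable fun q : E n × State n => ((2 * ε / m) • q.1, q.2) := by fun_prop
    exact (h.admissible.measurable_iterStep (γ := γ) (ζ := ζ) (ε := ε) h.M_pos h.m_pos
      h.α_mem.2.le h.β_mem).comp h1
  have hA : MeasurableSet {s : State n | ¬ Stopped ε f s} :=
    h.admissible.measurableSet_stopped.compl
  set X : ℕ → Ω → State n := fun k ω =>
    run M m α β γ ζ ε f x₀ (fun j => (2 * ε / m) • Z j ω) k with hX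
  have h1 : P {ω | X k ω ∈ {s : State n | ¬ Stopped ε f s}} =
      survival (stdGaussian (E n)) step {s | ¬ Stopped ε f s} k (x₀, 0) :=
    measure_mem_eq_survival hstep hA hZm hZlaw hZind (fun _ => rfl) (fun _ _ => rfl) k
  calc _ ≤ P {ω | X k ω ∈ {s : State n | ¬ Stopped ε f s}} := by
        refine measure_mono_ae ?_
        filter_upwards [hZae] with ω hω hns
        have h2 : (fun j => ξ j ω) = fun j => (2 * ε / m) • Z j ω := funext hω
        change ¬ Stopped ε f (run M m α β γ ζ ε f x₀ (fun j => (2 * ε / m) • Z j ω) k)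
        rw [← h2]
        exact hns
    _ ≤ _ := by
        rw [h1]
        exact survival_le_pow_mul hV hdrift ENNReal.ofReal_ne_top k _

end NCN

theorem mainTheorem1 (n : ℕ) (M L m α β γ ζ δ D : ℝ)
    (hM : 0 < M) (hL : 0 < L) (hm : 0 < m) (hα : α ∈ Set.Ioo (0 : ℝ) (1 / 2))
    (hβ : β ∈ Set.Ioo (0 : ℝ) 1) (hγ : γ ∈ Set.Ioo (0 : ℝ) 1) (hζ : ζ ∈ Set.Ioo (0 : ℝ) 1)
    (hδ : 0 < δ) :
    ∃ C : ℝ, 0 < C ∧ ∃ ε₀ : ℝ, 0 < ε₀ ∧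
      ∀ (f : NCN.E n → ℝ) (x₀ : NCN.E n) (κ : ℝ), 2 * m < κ → NCN.IsAdmissible M L κ f →
        (∀ x, ‖gradient f x‖ ≤ δ → ∃ c, gradient f c = 0 ∧ ‖x - c‖ < m / L) →
        (∀ y, f x₀ - f y ≤ D) →
        ∀ ε ∈ Set.Ioo (0 : ℝ) ε₀, ∀ p ∈ Set.Ioo (0 : ℝ) 1,
          ∀ (Ω : Type*) [MeasurableSpace Ω] (P : MeasureTheory.Measure Ω)
            [MeasureTheory.IsProbabilityMeasure P] (ξ : ℕ → Ω → NCN.E n),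
            NCN.IsGaussianNoise P (2 * ε / m) ξ →
            P {ω | ¬ ∃ k : ℕ,
                (k : ℝ) ≤ C * (1 + Real.log (1 / p) + Real.log (1 / ε)) ∧
                ∃ s : NCN.State n,
                  s = NCN.run M m α β γ ζ ε f x₀ (fun j => ξ j ω) k ∧
                  NCN.Stopped ε f s ∧ ‖gradient f s.1‖ ≤ ε ∧
                  (∀ v : NCN.E n, v ≠ 0 → 0 < inner ℝ (NCN.hessian f s.1 v) v) ∧
                  ∃ z : NCN.E n, IsLocalMin f z ∧ m * ‖s.1 - z‖ ≤ ε}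
              ≤ ENNReal.ofReal p := by
  -- constants that describe the landscape and the Gaussian noise
  obtain ⟨d, hd0, hdδ, hdL⟩ : ∃ d : ℝ, 0 < d ∧ d ≤ δ ∧ d ≤ m ^ 2 / (2 * L) :=
    ⟨min δ (m ^ 2 / (2 * L)), lt_min hδ (by positivity), min_le_left _ _, min_le_right _ _⟩
  obtain ⟨q, hq0, hq⟩ := NCN.exists_le_stdGaussian_ball n (R := 1 / 2 + M / (2 * m))
    (show 0 < m / (16 * M) by positivity)
  obtain ⟨η, hη0, hint, hint_le⟩ := NCN.exists_integral_exp_le n (show 0 < q / 4 by positivity)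
  -- The cost of a draw has to stay below `η (1 + ‖z‖ ^ 2)`: the `arsinh` term of weight `a`, the
  -- burst of weight `τ`, and the terms vanishing with `ε` may each use a third of `η`.
  set A : ℝ := 2 / m + 2 * M / m ^ 2 with hA
  have hA0 : 0 < A := by positivity
  set a : ℝ := min 1 (η / (3 * A)) with ha
  have ha0 : 0 < a := lt_min one_pos (by positivity)
  have ha1 : a ≤ 1 := min_le_left _ _
  have haA : a * A ≤ η / 3 := by
    have h1 : a ≤ η / (3 * A) := min_le_right _ _
    calc a * A ≤ η / (3 * A) * A := by gcongr
      _ = η / 3 := by field_simp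
  set τ : ℝ := η / (3 * (NCN.burst γ ζ + 1)) with hτ
  have hτ0 : 0 < τ := by positivity
  have hτB : τ * NCN.burst γ ζ ≤ η / 3 := by
    rw [hτ, div_mul_eq_mul_div, div_le_div_iff₀ (by positivity) (by positivity)]
    nlinarith
  set c₁ := NCN.decreaseConst M m α β * (d / (1 + M / m)) ^ 2 with hc₁
  have hc₁0 : 0 < c₁ := by
    have := NCN.decreaseConst_pos hM hm hα.1 hβ.1
    positivity
  set T₀ : ℝ := Real.log (1 + 2 * (M / (2 * m ^ 2) * d ^ 2)) + 2 with hT₀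
  have hT₀0 : 0 < T₀ := by
    have : 0 ≤ Real.log (1 + 2 * (M / (2 * m ^ 2) * d ^ 2)) :=
      Real.log_nonneg (by linarith [show 0 ≤ M / (2 * m ^ 2) * d ^ 2 by positivity])
    linarith
  -- the drift factor
  set ρ : ℝ := max (max (Real.exp (-τ)) (Real.exp (-min 1 (a * NCN.gapRate M m α β / 2))))
    (1 - q / 4) with hρ
  have hρ0 : 0 < ρ := lt_max_of_lt_left (lt_max_of_lt_left (Real.exp_pos _))
  have hρ1 : ρ < 1 := by
    have h1 : 0 < min 1 (a * NCN.gapRate M m α β / 2) := by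
      have := NCN.gapRate_pos hM hm hα.1 hβ.1
      exact lt_min one_pos (by positivity)
    refine max_lt (max_lt ?_ ?_) (by linarith)
    · exact Real.exp_lt_one_iff.2 (by linarith)
    · exact Real.exp_lt_one_iff.2 (by linarith)
  obtain ⟨ν, hν⟩ : ∃ ν : ℝ, ν = -Real.log ρ := ⟨_, rfl⟩
  have hν0 : 0 < ν := by linarith [Real.log_neg hρ0 hρ1]
  set Q : ℝ := (3 / c₁ * |D| + 2) * T₀ with hQ
  have hQ0 : 0 < Q := by positivity
  -- smallness of the accuracy
  have hsmall : ∀ B₁ B₂ : ℝ, 0 < B₂ → ∀ᶠ ε in nhdsWithin (0 : ℝ) (Set.Ioi 0), B₁ * ε < B₂ :=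
    fun B₁ B₂ hB => by
      have h1 : Filter.Tendsto (fun ε : ℝ => B₁ * ε) (nhdsWithin 0 (Set.Ioi 0)) (nhds 0) := by
        have : Filter.Tendsto (fun ε : ℝ => B₁ * ε) (nhds 0) (nhds (B₁ * 0)) :=
          (continuous_const_mul B₁).tendsto 0
        rw [mul_zero] at this
        exact this.mono_left nhdsWithin_le_nhds
      exact h1.eventually_lt_const hB
  have hev := (hsmall 1 1 one_pos).and <| (hsmall (2 * Real.sqrt n * (M / m) + 1) d hd0).and <|
    (hsmall (8 * (L * M ^ 2 / m ^ 4)) 1 one_pos).and <|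
    (hsmall (8 * (L * M ^ 2 / m ^ 4)) (M / m) (by positivity)).and <|
    (hsmall (1 / m + M / m ^ 2 + 1 / (8 * M)) (m / L) (by positivity)).and <|
    hsmall ((3 / c₁ * A + 8 * L ^ 2 / m ^ 4) * T₀) (η / 3) (by positivity)
  obtain ⟨ε₀, hε₀, hε₀sub⟩ := mem_nhdsGT_iff_exists_Ioo_subset.1 hev
  refine ⟨1 + (Q + 1) / ν, by positivity, ε₀, hε₀, ?_⟩
  intro f x₀ κ hκ hf hnear hD ε hε p hp Ω _ P _ ξ hξ
  obtain ⟨hε1, hεd, hεa, hεb, hεc, hεη⟩ := hε₀sub hε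
  have hε0 : 0 < ε := hε.1
  rw [one_mul] at hε1
  have hland : NCN.Landscape M L m α β κ d f :=
    ⟨hf, hM, hL, hm, hκ, hα, hβ, hd0, hdL, fun x hx => hnear x (hx.trans hdδ)⟩
  set Λ := NCN.localBound M m d ε with hΛ
  have hΛ1 : 1 ≤ Λ := NCN.one_le_localBound hM.le
  set θ : ℝ := 3 / c₁ * Λ with hθ
  have hθ0 : 0 ≤ θ := by positivity
  set Φ₀ : ℝ := θ * (f x₀ - |D|) - Λ with hΦ₀
  have hdrift := hland.lintegral_driftFunction_le (a := a) (θ := θ) (τ := τ) (Φ₀ := Φ₀) (η := η)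
    (q := q) (ρ := ρ) (γ := γ) (ζ := ζ) hε0 ha0.le ha1 hτ0.le
    (by rw [← hc₁, hθ]; field_simp; exact le_rfl) hεd.le (by linarith) (by linarith) hεc
    (by
      have h1 := NCN.localBound_mul_sq_le (m := m) (d := d) hM.le hε0 hε1.le
      have h2 : (3 / c₁ * A + 8 * L ^ 2 / m ^ 4) * (Λ * ε ^ 2) ≤
          (3 / c₁ * A + 8 * L ^ 2 / m ^ 4) * (T₀ * ε) := by gcongr
      have h3 : (θ * ε ^ 2 + a) * A + 8 * Λ * L ^ 2 * ε ^ 2 / m ^ 4 =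
          (3 / c₁ * A + 8 * L ^ 2 / m ^ 4) * (Λ * ε ^ 2) + a * A := by rw [hθ]; ring
      linarith)
    hq hint hint_le hρ0.le ((le_max_left _ _).trans (le_max_left _ _))
    ((le_max_right _ _).trans (le_max_left _ _)) (le_max_right _ _)
  have hV : ∀ s, ¬ NCN.Stopped ε f s → 1 ≤ NCN.driftFunction M L m d a ε θ τ Φ₀ f s := by
    intro s hs
    rw [NCN.driftFunction, if_neg hs, ENNReal.one_le_ofReal]
    refine Real.one_le_exp ?_
    have h1 := (abs_le.1 (hland.abs_localPotential_le (ε := ε) ha0.le ha1 s.1)).1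
    have h2 : f x₀ - |D| ≤ f s.1 := by linarith [hD s.1, le_abs_self D]
    have h3 := mul_le_mul_of_nonneg_left h2 hθ0
    have h4 : 0 ≤ τ * (s.2 : ℝ) := by positivity
    rw [NCN.statePotential, NCN.pointPotential]
    linarith
  set T : ℝ := 1 + Real.log (1 / p) + Real.log (1 / ε) with hT
  have hp0 : 0 < p := hp.1
  have hlogp : 0 ≤ Real.log (1 / p) := Real.log_nonneg (by rw [le_div_iff₀ hp0]; linarith [hp.2])
  have hlogε : 0 ≤ Real.log (1 / ε) := Real.log_nonneg (by rw [le_div_iff₀ hε0]; linarith)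
  have hT1 : 1 ≤ T := by linarith
  have hCT0 : 0 ≤ (1 + (Q + 1) / ν) * T := by positivity
  set k := ⌊(1 + (Q + 1) / ν) * T⌋₊ with hk
  have hkle : (k : ℝ) ≤ (1 + (Q + 1) / ν) * T := Nat.floor_le hCT0
  have hkge : (Q + 1) / ν * T ≤ k := by
    have h1 := Nat.lt_floor_add_one ((1 + (Q + 1) / ν) * T)
    rw [← hk, add_mul, one_mul] at h1
    linarith
  calc _ ≤ P {ω | ¬ NCN.Stopped ε f (NCN.run M m α β γ ζ ε f x₀ (fun j => ξ j ω) k)} := by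
        refine measure_mono fun ω hω hst => hω ⟨k, hkle, _, rfl, hst, hst.2.1, ?_⟩
        obtain ⟨c, hc, hxc⟩ := hland.exists_critical _ (hst.2.1.trans (by
          have : 0 ≤ 2 * Real.sqrt n * (M / m) * ε := by positivity
          linarith))
        obtain ⟨h1, h2, h3⟩ := hf.conclusion_of_not_hasNegativeCurvature hL hm hκ hc hxc.le hst.2.2
        exact ⟨h1, c, h2, h3.trans hst.2.1⟩
    _ ≤ ENNReal.ofReal ρ ^ k * NCN.driftFunction M L m d a ε θ τ Φ₀ f (x₀, 0) :=
        hland.measure_not_stopped_le hε0 hV hdrift x₀ P hξ k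
    _ ≤ ENNReal.ofReal ρ ^ k * ENNReal.ofReal (Real.exp (Q * T)) := by
        gcongr
        refine (NCN.driftFunction_le _).trans (ENNReal.ofReal_le_ofReal (Real.exp_le_exp.2 ?_))
        have h1 := (abs_le.1 (hland.abs_localPotential_le (ε := ε) ha0.le ha1 x₀)).2
        have h2 : NCN.statePotential M L m d a ε θ τ f (x₀, 0) - Φ₀ ≤
            (3 / c₁ * |D| + 2) * Λ := by
          rw [NCN.statePotential, NCN.pointPotential, hΦ₀]
          simp only [Nat.cast_zero, mul_zero, add_zero]
          have : θ * |D| = 3 / c₁ * |D| * Λ := by rw [hθ]; ring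
          linarith
        have h3 : Λ ≤ T₀ * T := (NCN.localBound_le_log hM.le hε0 hε1.le).trans (by
          rw [← hT₀]; gcongr; linarith)
        calc _ ≤ (3 / c₁ * |D| + 2) * Λ := h2
          _ ≤ (3 / c₁ * |D| + 2) * (T₀ * T) := by gcongr
          _ = Q * T := by rw [hQ]; ring
    _ ≤ ENNReal.ofReal p := by
        rw [← ENNReal.ofReal_pow hρ0.le, ← ENNReal.ofReal_mul (by positivity)]
        refine ENNReal.ofReal_le_ofReal ?_
        have h1 : ρ ^ k = Real.exp (k * Real.log ρ) := by
          rw [Real.exp_nat_mul, Real.exp_log hρ0]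
        rw [h1, ← Real.exp_add, ← Real.exp_log hp0]
        refine Real.exp_le_exp.2 ?_
        have h2 : (Q + 1) * T ≤ k * ν := by
          calc (Q + 1) * T = (Q + 1) / ν * T * ν := by field_simp
            _ ≤ _ := by gcongr
        have h3 : Real.log (1 / p) = -Real.log p := by rw [one_div, Real.log_inv]
        have h4 : (k : ℝ) * Real.log ρ = -(k * ν) := by rw [hν]; ring
        linarith
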